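/- **Theorem.** For every pair of real numbers $1\le p<q$ there is a constant $c_{p,q}>0$, depending only on $(p,q)$ (and not on the dimension), such that the following holds. Let $d\ge 1$ and $n\ge 1$ be integers, let $\mathbb R^d$ carry the Euclidean norm $\|\cdot\|$, let $\mu$ be a Borel probability measure on $\mathbb R^d$ with $$M_q:=\Big(\int \|x\|^q\,\mu(dx)\Big)^{1/q}<\infty ,$$ let $X_1,\dots,X_n$ be independent random vectors with law $\mu$, and let $\hat\mu=\frac1n\sum_{i=1}^n\delta_{X_i}$ be their empirical measure. Let $$W_p(\nu,\mu)=\inf_{\xi}\Big(\int\|x-y\|^p\,\xi(dx,dy)\Big)^{1/p},$$ the infimum being over all measures $\xi$ on $\mathbb R^d\times\mathbb R^d$ with marginals $\nu$ and $\mu$. Put $$\zeta_{p,q,d}=\begin{cases}2 & \text{if } d=q=2p,\\ 1 & \text{if } d\ne 2p \text{ and } q=\frac{dp}{d-p}\wedge 2p,\ \text{ or if } q>d=2p,\\ 0 & \text{otherwise,}\end{cases}$$ where $\frac{dp}{d-p}$ is read as $+\infty$ if $d\le p$, and assume $n\ge 2$ if $\zeta_{p,q,d}\neq 0$. Then $$\mathbb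 E\,W_p(\hat\mu,\mu)\le c_{p,q}\,M_q\,n^{-\left[\frac1{(2p)\vee d}\wedge\left(\frac1p-\frac1q\right)\right]}(\log n)^{\zeta_{p,q,d}/p},$$ where the last factor is $1$ if $\zeta_{p,q,d}=0$. -/

import Mathlib

open MeasureTheory ProbabilityTheory
open scoped ENNReal

/-- The couplings of `μ` and `ν`: measures on the product with marginals `μ` and `ν`. -/
def couplings {E : Type*} [MeasurableSpace E] (μ ν : Measure E) : Set (Measure (E × E)) :=
  {ξ | ξ.map Prod.fst = μ ∧ ξ.map Prod.snd = ν}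

/-- The Wasserstein distance of order `p`, with values in `[0, ∞]`:
the infimum over all couplings of `(E ‖X - Y‖ ^ p) ^ (1 / p)`. -/
noncomputable def wasserstein {E : Type*} [NormedAddCommGroup E] [MeasurableSpace E]
    (p : ℝ) (μ ν : Measure E) : ℝ≥0∞ :=
  ⨅ ξ ∈ couplings μ ν, (∫⁻ z, ‖z.1 - z.2‖ₑ ^ p ∂ξ) ^ (1 / p)

/-- The empirical measure of the points `x₁, …, xₙ`: mass `1 / n` at each of them. -/
noncomputable def empiricalMeasure {E : Type*} [MeasurableSpace E] {n : ℕ} (x : Fin n → E) :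
    Measure E :=
  (n : ℝ≥0∞)⁻¹ • ∑ i, Measure.dirac (x i)

/-- The rate exponent `1 / ((2p) ∨ d) ∧ (1 / p - 1 / q)`. -/
noncomputable def rateExponent (p q : ℝ) (d : ℕ) : ℝ :=
  min (1 / max (2 * p) (d : ℝ)) (1 / p - 1 / q)

/-- The critical moment order `(d p / (d - p)) ∧ (2 p)`, where `d p / (d - p)` is read as `+∞`
when `d ≤ p`. -/
noncomputable def criticalMoment (p : ℝ) (d : ℕ) : ℝ :=
  if (d : ℝ) ≤ p then 2 * p else min ((d : ℝ) * p / ((d : ℝ) - p)) (2 * p)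

open Classical in
/-- The exponent `ζ` of the logarithm: `2` if `d = q = 2p`; `1` if `d ≠ 2p` and `q` is the critical
moment order, or if `q > d = 2p`; and `0` otherwise. -/
noncomputable def logExponent (p q : ℝ) (d : ℕ) : ℝ :=
  if (d : ℝ) = 2 * p ∧ q = 2 * p then 2
  else if ((d : ℝ) ≠ 2 * p ∧ q = criticalMoment p d) ∨ ((d : ℝ) = 2 * p ∧ (d : ℝ) < q) then 1
  else 0

theorem withDensity_comp_apply_cell {E ι : Type*} [MeasurableSpace E] [MeasurableSpace ι]
    [MeasurableSingletonClass ι] (μ : Measure E) {π : E → ι} (hπ : Measurable π)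
    (s : ι → ℝ≥0∞) (i : ι) :
    μ.withDensity (fun x => s (π x)) (π ⁻¹' {i}) = s i * μ (π ⁻¹' {i}) := by
  have hm : MeasurableSet (π ⁻¹' {i}) := hπ (measurableSet_singleton i)
  rw [withDensity_apply _ hm, setLIntegral_congr_fun hm (g := fun _ => s i)
    (fun x hx => by rw [Set.mem_preimage, Set.mem_singleton_iff] at hx; simp only [hx]),
    setLIntegral_const]

/-! ### Transport by successive refinement of partitions -/

section Cellwise

variable {E ι : Type*} [MeasurableSpace E] [MeasurableSpace ι] [MeasurableSingletonClass ι]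
  [Countable ι]

/-- Two finite measures giving the same mass to every cell of a countable partition have a coupling
that never moves mass from one cell to another. -/
theorem exists_coupling_cellwise {α β : Measure E} [IsFiniteMeasure α] [IsFiniteMeasure β]
    {π : E → ι} (hπ : Measurable π) (h : ∀ i, α (π ⁻¹' {i}) = β (π ⁻¹' {i})) :
    ∃ ξ : Measure (E × E), ξ.map Prod.fst = α ∧ ξ.map Prod.snd = β ∧
      ∀ᵐ z ∂ξ, π z.1 = π z.2 := by
  have hm : ∀ i, MeasurableSet (π ⁻¹' {i}) := fun i => hπ (measurableSet_singleton i)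
  have hd : Pairwise (Function.onFun Disjoint fun i => π ⁻¹' {i}) := by
    intro i j hij
    exact Disjoint.preimage _ (Set.disjoint_singleton.2 hij)
  have hU : (⋃ i, π ⁻¹' {i}) = Set.univ := by
    ext x; simp
  have hsum : ∀ γ : Measure E, Measure.sum (fun i => γ.restrict (π ⁻¹' {i})) = γ := by
    intro γ
    rw [← Measure.restrict_iUnion hd hm, hU, Measure.restrict_univ]
  -- Independent coupling on each cell, normalised by the common cell mass. On a null cell the
  -- factor is `⊤`, but the restricted measures vanish there.
  refine ⟨Measure.sum fun i => (α (π ⁻¹' {i}))⁻¹ •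
    (α.restrict (π ⁻¹' {i})).prod (β.restrict (π ⁻¹' {i})), ?_, ?_, ?_⟩
  · rw [Measure.map_sum measurable_fst.aemeasurable]
    conv_rhs => rw [← hsum α]
    congr 1
    ext1 i
    rw [Measure.map_smul, Measure.map_fst_prod, Measure.restrict_apply_univ, ← h i, smul_smul]
    by_cases h0 : α (π ⁻¹' {i}) = 0
    · rw [Measure.restrict_eq_zero.2 h0, smul_zero]
    · rw [ENNReal.inv_mul_cancel h0 (measure_ne_top _ _), one_smul]
  · rw [Measure.map_sum measurable_snd.aemeasurable]
    conv_rhs => rw [← hsum β]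
    congr 1
    ext1 i
    rw [Measure.map_smul, Measure.map_snd_prod, Measure.restrict_apply_univ, smul_smul]
    by_cases h0 : α (π ⁻¹' {i}) = 0
    · rw [Measure.restrict_eq_zero.2 ((h i).symm.trans h0), smul_zero]
    · rw [ENNReal.inv_mul_cancel h0 (measure_ne_top _ _), one_smul]
  · rw [Measure.ae_sum_iff]
    intro i
    refine Measure.ae_smul_measure ?_ _
    rw [Measure.prod_restrict]
    filter_upwards [ae_restrict_mem ((hm i).prod (hm i))] with z hz
    exact hz.1.trans hz.2.symm

theorem lintegral_comp_withDensity_comp (μ : Measure E) {π : E → ι} (hπ : Measurable π)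
    (s G : ι → ℝ≥0∞) :
    ∫⁻ x, G (π x) ∂(μ.withDensity fun x => s (π x)) = ∑' i, G i * (s i * μ (π ⁻¹' {i})) := by
  rw [← lintegral_map (Measurable.of_discrete (f := G)) hπ, lintegral_countable']
  refine tsum_congr fun i => ?_
  rw [Measure.map_apply hπ (measurableSet_singleton i), withDensity_comp_apply_cell μ hπ]

theorem lintegral_comp_eq_tsum (μ : Measure E) {π : E → ι} (hπ : Measurable π) (G : ι → ℝ≥0∞) :
    ∫⁻ x, G (π x) ∂μ = ∑' i, G i * μ (π ⁻¹' {i}) := by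
  rw [← lintegral_map (Measurable.of_discrete (f := G)) hπ, lintegral_countable']
  refine tsum_congr fun i => ?_
  rw [Measure.map_apply hπ (measurableSet_singleton i)]

theorem isFiniteMeasure_withDensity_le_one (μ : Measure E) [IsFiniteMeasure μ] {g : E → ℝ≥0∞}
    (hg : ∀ x, g x ≤ 1) : IsFiniteMeasure (μ.withDensity g) := by
  refine isFiniteMeasure_withDensity (ne_top_of_le_ne_top (measure_ne_top μ Set.univ) ?_)
  calc ∫⁻ x, g x ∂μ ≤ ∫⁻ _, 1 ∂μ := lintegral_mono hg
    _ = μ Set.univ := lintegral_one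

/-- If the mass of two measures agrees on every cell, so it does on every union of cells. -/
theorem measure_preimage_eq_of_cells {α β : Measure E} {π : E → ι} (hπ : Measurable π)
    (h : ∀ i, α (π ⁻¹' {i}) = β (π ⁻¹' {i})) (S : Set ι) : α (π ⁻¹' S) = β (π ⁻¹' S) := by
  have hS : MeasurableSet S := S.to_countable.measurableSet
  have : α.map π = β.map π := Measure.ext_of_singleton fun i => by
    rw [Measure.map_apply hπ (measurableSet_singleton i),
      Measure.map_apply hπ (measurableSet_singleton i), h i]
  rw [← Measure.map_apply hπ hS, this, Measure.map_apply hπ hS]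

/-- The cost of a coupling that stays within cells, when the cost of moving within the cells is
dominated by a function of the end points. -/
theorem lintegral_le_of_cellwise {κ : Type*} {ξ : Measure (E × E)} {π : E → ι} (hπ : Measurable π)
    {π' : E → κ} {c : E × E → ℝ≥0∞} {G : ι → ℝ≥0∞}
    (hc : ∀ x y, π' x = π' y → c (x, y) ≤ G (π x) + G (π y))
    (hξ : ∀ᵐ z ∂ξ, π' z.1 = π' z.2) :
    ∫⁻ z, c z ∂ξ ≤ ∫⁻ x, G (π x) ∂(ξ.map Prod.fst) + ∫⁻ x, G (π x) ∂(ξ.map Prod.snd) := by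
  have hG : Measurable fun x => G (π x) := (Measurable.of_discrete (f := G)).comp hπ
  have hG1 : Measurable fun z : E × E => G (π z.1) := hG.comp measurable_fst
  rw [lintegral_map hG measurable_fst, lintegral_map hG measurable_snd, ← lintegral_add_left hG1]
  refine lintegral_mono_ae ?_
  filter_upwards [hξ] with z hz
  exact hc z.1 z.2 hz

/-- A transport plan, of cost at most `K`, of a part of `μ` onto a part of `ν`, such that what is
left has on each cell of the partition the shapes of `μ` and `ν`, and equal masses. -/
def PartialTransport (μ ν : Measure E) (c : E × E → ℝ≥0∞) (π : E → ι) (K : ℝ≥0∞) : Prop :=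
  ∃ (ξ : Measure (E × E)) (s t : ι → ℝ≥0∞), (∀ i, s i ≤ 1) ∧ (∀ i, t i ≤ 1) ∧
    (∀ i, s i * μ (π ⁻¹' {i}) = t i * ν (π ⁻¹' {i})) ∧
    ξ.map Prod.fst + μ.withDensity (fun x => s (π x)) = μ ∧
    ξ.map Prod.snd + ν.withDensity (fun x => t (π x)) = ν ∧ ∫⁻ z, c z ∂ξ ≤ K

/-- The discrepancy of two measures on a cell. -/
noncomputable def discrepancy (μ ν : Measure E) (A : Set E) : ℝ≥0∞ := (μ A - ν A) + (ν A - μ A)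

theorem min_div_mul_self {a b m : ℝ≥0∞} (hm : m ≠ ⊤) :
    min (a * m) b / m * m = min (a * m) b := by
  by_cases h : m = 0
  · simp [h]
  · exact ENNReal.div_mul_cancel h hm

theorem min_div_le {a b m : ℝ≥0∞} : min (a * m) b / m ≤ a :=
  ENNReal.div_le_of_le_mul (min_le_left _ _)

theorem self_sub_min {a b : ℝ≥0∞} : a - min a b = a - b := by
  rcases le_total a b with h | h
  · rw [min_eq_left h, tsub_self, tsub_eq_zero_of_le h]
  · rw [min_eq_right h]

/-- One refinement step: remaining masses with equal cell masses for the coarse partition `f ∘ π`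
are matched as far as possible within the cells of `π`, and the excess is moved within the coarse
cells. -/
theorem exists_refinement {μ ν : Measure E} [IsFiniteMeasure μ] [IsFiniteMeasure ν]
    {π : E → ι} (hπ : Measurable π) {f : ι → ι} {c : E × E → ℝ≥0∞} {G : ι → ℝ≥0∞}
    (hc : ∀ x y, f (π x) = f (π y) → c (x, y) ≤ G (π x) + G (π y))
    {s t : ι → ℝ≥0∞} (hs : ∀ i, s i ≤ 1) (ht : ∀ i, t i ≤ 1)
    (hst : ∀ k, s k * μ ((fun x => f (π x)) ⁻¹' {k}) = t k * ν ((fun x => f (π x)) ⁻¹' {k})) :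
    ∃ (ξ : Measure (E × E)) (s' t' : ι → ℝ≥0∞), (∀ i, s' i ≤ 1) ∧ (∀ i, t' i ≤ 1) ∧
      (∀ i, s' i * μ (π ⁻¹' {i}) = t' i * ν (π ⁻¹' {i})) ∧
      ξ.map Prod.fst + μ.withDensity (fun x => s' (π x)) = μ.withDensity (fun x => s (f (π x))) ∧
      ξ.map Prod.snd + ν.withDensity (fun x => t' (π x)) = ν.withDensity (fun x => t (f (π x))) ∧
      ∫⁻ z, c z ∂ξ ≤ ∑' i, G i * (s (f i) * μ (π ⁻¹' {i}) - t (f i) * ν (π ⁻¹' {i})) +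
        ∑' i, G i * (t (f i) * ν (π ⁻¹' {i}) - s (f i) * μ (π ⁻¹' {i})) := by
  have hf : Measurable f := Measurable.of_discrete
  set a : ι → ℝ≥0∞ := fun i => s (f i) * μ (π ⁻¹' {i}) with ha
  set b : ι → ℝ≥0∞ := fun i => t (f i) * ν (π ⁻¹' {i}) with hb
  -- Densities that keep exactly the common mass `min (a i) (b i)` on each fine cell. The rest, `α`
  -- and `β` below, is what has to move.
  set s' : ι → ℝ≥0∞ := fun i => min (a i) (b i) / μ (π ⁻¹' {i}) with hs'
  set t' : ι → ℝ≥0∞ := fun i => min (b i) (a i) / ν (π ⁻¹' {i}) with ht'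
  have hsμ : ∀ i, s' i * μ (π ⁻¹' {i}) = min (a i) (b i) := fun i =>
    min_div_mul_self (measure_ne_top _ _)
  have htν : ∀ i, t' i * ν (π ⁻¹' {i}) = min (b i) (a i) := fun i =>
    min_div_mul_self (measure_ne_top _ _)
  have hs's : ∀ i, s' i ≤ s (f i) := fun i => min_div_le
  have ht't : ∀ i, t' i ≤ t (f i) := fun i => min_div_le
  have hm : ∀ u : ι → ℝ≥0∞, Measurable fun x => u (π x) := fun u =>
    (Measurable.of_discrete (f := u)).comp hπ
  have hsplit : ∀ (γ : Measure E) (u v : ι → ℝ≥0∞), (∀ i, v i ≤ u i) →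
      γ.withDensity (fun x => u (π x) - v (π x)) + γ.withDensity (fun x => v (π x)) =
        γ.withDensity (fun x => u (π x)) := by
    intro γ u v huv
    rw [← withDensity_add_right _ (hm v)]
    congr 1
    ext x
    exact tsub_add_cancel_of_le (huv _)
  set α := μ.withDensity (fun x => s (f (π x)) - s' (π x)) with hα
  set β := ν.withDensity (fun x => t (f (π x)) - t' (π x)) with hβ
  have hα1 := hsplit μ (fun i => s (f i)) s' hs's
  have hβ1 := hsplit ν (fun i => t (f i)) t' ht't
  have : IsFiniteMeasure α := isFiniteMeasure_withDensity_le_one μ fun x =>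
    tsub_le_self.trans (hs _)
  have : IsFiniteMeasure β := isFiniteMeasure_withDensity_le_one ν fun x =>
    tsub_le_self.trans (ht _)
  have fin1 : IsFiniteMeasure (μ.withDensity fun x => s' (π x)) :=
    isFiniteMeasure_withDensity_le_one μ fun x => (hs's _).trans (hs _)
  -- On a coarse cell the total remaining masses agree by `hst` and the kept masses agree cell by
  -- cell. Subtracting the kept mass, which is finite, leaves equal excesses.
  have heq : ∀ k, α ((fun x => f (π x)) ⁻¹' {k}) = β ((fun x => f (π x)) ⁻¹' {k}) := by
    intro k
    have e1 : (μ.withDensity fun x => s' (π x)) ((fun x => f (π x)) ⁻¹' {k}) =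
        (ν.withDensity fun x => t' (π x)) ((fun x => f (π x)) ⁻¹' {k}) :=
      measure_preimage_eq_of_cells hπ (fun i => by
        rw [withDensity_comp_apply_cell _ hπ, withDensity_comp_apply_cell _ hπ, hsμ, htν,
          min_comm]) (f ⁻¹' {k})
    have e2 : (μ.withDensity fun x => s (f (π x))) ((fun x => f (π x)) ⁻¹' {k}) =
        (ν.withDensity fun x => t (f (π x))) ((fun x => f (π x)) ⁻¹' {k}) := by
      exact (withDensity_comp_apply_cell μ (hf.comp hπ) s k).trans
        ((hst k).trans (withDensity_comp_apply_cell ν (hf.comp hπ) t k).symm)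
    rw [← hα1, ← hβ1, Measure.add_apply, Measure.add_apply, e1] at e2
    refine (ENNReal.add_left_inj ?_).1 e2
    rw [← e1]
    exact measure_ne_top _ _
  obtain ⟨ξ, h1, h2, h3⟩ := exists_coupling_cellwise (hf.comp hπ) heq
  refine ⟨ξ, s', t', fun i => (hs's i).trans (hs _), fun i => (ht't i).trans (ht _), ?_, ?_, ?_, ?_⟩
  · intro i
    rw [hsμ, htν, min_comm]
  · rw [h1]; exact hα1
  · rw [h2]; exact hβ1
  · refine (lintegral_le_of_cellwise hπ hc h3).trans (le_of_eq ?_)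
    rw [h1, h2, hα, hβ, lintegral_comp_withDensity_comp μ hπ (fun i => s (f i) - s' i),
      lintegral_comp_withDensity_comp ν hπ (fun i => t (f i) - t' i)]
    congr 1
    · refine tsum_congr fun i => ?_
      rw [ENNReal.sub_mul fun _ _ => measure_ne_top _ _, hsμ, self_sub_min]
    · refine tsum_congr fun i => ?_
      rw [ENNReal.sub_mul fun _ _ => measure_ne_top _ _, htν, self_sub_min]

/-- Start of the induction: a refinement of the trivial partition, encoded by a constant `f`, with
no mass moved yet (s = t = 1). The constant needs a point of `E`, hence the separate empty case. -/
theorem PartialTransport.of_univ {μ ν : Measure E} [IsFiniteMeasure μ] [IsFiniteMeasure ν]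
    (h : μ Set.univ = ν Set.univ) {π : E → ι} (hπ : Measurable π)
    {c : E × E → ℝ≥0∞} {G : ι → ℝ≥0∞} (hc : ∀ x y, c (x, y) ≤ G (π x) + G (π y)) :
    PartialTransport μ ν c π (∑' i, G i * discrepancy μ ν (π ⁻¹' {i})) := by
  rcases isEmpty_or_nonempty E with hE | ⟨⟨x₀⟩⟩
  · have h1 : μ = 0 := Measure.eq_zero_of_isEmpty μ
    have h2 : ν = 0 := Measure.eq_zero_of_isEmpty ν
    exact ⟨0, 1, 1, fun _ => le_rfl, fun _ => le_rfl, by simp [h1, h2], by simp [h1],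
      by simp [h2], by simp⟩
  obtain ⟨ξ, s', t', hs', ht', hst', h1, h2, h3⟩ := exists_refinement (μ := μ) (ν := ν)
    (s := fun _ => 1) (t := fun _ => 1) hπ
    (f := fun _ => π x₀) (c := c) (G := G) (fun x y _ => hc x y) (fun _ => le_rfl)
    (fun _ => le_rfl) (by
      intro k
      by_cases hi : π x₀ = k
      · simp [hi, h]
      · simp [Set.preimage_const_of_notMem (show π x₀ ∉ ({k} : Set ι) from hi)])
  refine ⟨ξ, s', t', hs', ht', hst', h1.trans ?_, h2.trans ?_, h3.trans (le_of_eq ?_)⟩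
  · exact withDensity_one
  · exact withDensity_one
  · rw [← ENNReal.tsum_add]
    refine tsum_congr fun i => ?_
    rw [one_mul, one_mul, ← mul_add, discrepancy]

/-- `s μ(B) - t ν(B)` summed over the cells. -/
theorem tsum_cell_excess_le {μ ν : Measure E} [IsFiniteMeasure μ] [IsFiniteMeasure ν]
    {π : E → ι} (hπ : Measurable π) {f : ι → ι} (G : ι → ℝ≥0∞)
    {s t : ι → ℝ≥0∞} (hs : ∀ i, s i ≤ 1)
    (hst : ∀ k, s k * μ ((fun x => f (π x)) ⁻¹' {k}) = t k * ν ((fun x => f (π x)) ⁻¹' {k})) :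
    ∑' i, G (f i) * (s (f i) * μ (π ⁻¹' {i}) - t (f i) * ν (π ⁻¹' {i})) ≤
      ∑' i, G (f i) * (μ (π ⁻¹' {i}) - ν (π ⁻¹' {i})) +
      ∑' k, G k * (ν ((fun x => f (π x)) ⁻¹' {k}) - μ ((fun x => f (π x)) ⁻¹' {k})) := by
  have hf : Measurable f := Measurable.of_discrete
  -- With s ≤ 1, sμ - tν ≤ (μ - ν)⁺ + (s - t)⁺ν on a fine cell. Over a coarse cell F the last terms
  -- add up to (s - t)⁺ν(F) = s(ν(F) - μ(F))⁺, because tν(F) = sμ(F). Discrepancies of the original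
  -- measures thus suffice at every level.
  have key : ∀ i, G (f i) * (s (f i) * μ (π ⁻¹' {i}) - t (f i) * ν (π ⁻¹' {i})) ≤
      G (f i) * (μ (π ⁻¹' {i}) - ν (π ⁻¹' {i})) +
        G (f i) * (s (f i) - t (f i)) * ν (π ⁻¹' {i}) := by
    intro i
    rw [mul_assoc, ← mul_add]
    gcongr
    rw [tsub_le_iff_right]
    calc s (f i) * μ (π ⁻¹' {i})
        ≤ s (f i) * ((μ (π ⁻¹' {i}) - ν (π ⁻¹' {i})) + ν (π ⁻¹' {i})) := by
          gcongr; exact le_tsub_add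
      _ ≤ (μ (π ⁻¹' {i}) - ν (π ⁻¹' {i})) +
          ((s (f i) - t (f i)) + t (f i)) * ν (π ⁻¹' {i}) := by
          rw [mul_add]
          gcongr
          · exact mul_le_of_le_one_left' (hs _)
          · exact le_tsub_add
      _ = _ := by rw [add_mul, add_assoc]
  refine (ENNReal.tsum_le_tsum key).trans ?_
  rw [ENNReal.tsum_add]
  refine add_le_add le_rfl ?_
  rw [← lintegral_comp_eq_tsum ν hπ fun i => G (f i) * (s (f i) - t (f i)),
    show ∫⁻ x, G (f (π x)) * (s (f (π x)) - t (f (π x))) ∂ν = _ from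
      lintegral_comp_eq_tsum ν (hf.comp hπ) fun k => G k * (s k - t k)]
  refine ENNReal.tsum_le_tsum fun k => ?_
  change G k * (s k - t k) * ν ((fun x => f (π x)) ⁻¹' {k}) ≤ _
  rw [mul_assoc, ENNReal.sub_mul fun _ _ => measure_ne_top _ _, ← hst k,
    ← ENNReal.mul_sub fun _ _ => ((hs k).trans_lt ENNReal.one_lt_top).ne]
  gcongr
  exact mul_le_of_le_one_left' (hs _)

/-- The excess travels within coarse cells, so it is charged at the coarse cost `G (f i)`. The
coarse discrepancy reappears because the two remaining densities s and t differ. -/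
theorem PartialTransport.refine {μ ν : Measure E} [IsFiniteMeasure μ] [IsFiniteMeasure ν]
    {π : E → ι} (hπ : Measurable π) {f : ι → ι} {c : E × E → ℝ≥0∞} {G : ι → ℝ≥0∞} {K : ℝ≥0∞}
    (hc : ∀ x y, f (π x) = f (π y) → c (x, y) ≤ G (f (π x)))
    (h : PartialTransport μ ν c (fun x => f (π x)) K) :
    PartialTransport μ ν c π (K + (∑' i, G (f i) * discrepancy μ ν (π ⁻¹' {i}) +
      ∑' k, G k * discrepancy μ ν ((fun x => f (π x)) ⁻¹' {k}))) := by
  obtain ⟨ξ, s, t, hs, ht, hst, h1, h2, h3⟩ := h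
  obtain ⟨ξ', s', t', hs', ht', hst', h1', h2', h3'⟩ := exists_refinement (c := c)
    (G := fun i => G (f i)) hπ (fun x y hxy => (hc x y hxy).trans le_self_add) hs ht hst
  refine ⟨ξ + ξ', s', t', hs', ht', hst', ?_, ?_, ?_⟩
  · rw [Measure.map_add _ _ measurable_fst, add_assoc, h1', h1]
  · rw [Measure.map_add _ _ measurable_snd, add_assoc, h2', h2]
  · rw [lintegral_add_measure]
    refine add_le_add h3 (h3'.trans ?_)
    refine (add_le_add (tsum_cell_excess_le hπ G hs hst)
      (tsum_cell_excess_le hπ G ht fun k => (hst k).symm)).trans (le_of_eq ?_)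
    simp only [discrepancy, mul_add, ENNReal.tsum_add]
    ring

/-- What is left is coupled inside the finest cells. Both remainders have the same cell masses, at
most those of `ν`, so the cost involves `ν` alone; this matters since the moment bound is available
for the deterministic measure. -/
theorem PartialTransport.exists_coupling {μ ν : Measure E} [IsFiniteMeasure μ] [IsFiniteMeasure ν]
    {π : E → ι} (hπ : Measurable π) {c : E × E → ℝ≥0∞} {G : ι → ℝ≥0∞} {K : ℝ≥0∞}
    (hc : ∀ x y, π x = π y → c (x, y) ≤ G (π x)) (h : PartialTransport μ ν c π K) :
    ∃ ξ ∈ couplings μ ν, ∫⁻ z, c z ∂ξ ≤ K + 2 * ∫⁻ x, G (π x) ∂ν := by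
  obtain ⟨ξ, s, t, hs, ht, hst, h1, h2, h3⟩ := h
  have := isFiniteMeasure_withDensity_le_one μ fun x => hs (π x)
  have := isFiniteMeasure_withDensity_le_one ν fun x => ht (π x)
  obtain ⟨ξ', h1', h2', h3'⟩ := exists_coupling_cellwise
    (α := μ.withDensity fun x => s (π x)) (β := ν.withDensity fun x => t (π x)) hπ (fun i => by
      rw [withDensity_comp_apply_cell _ hπ, withDensity_comp_apply_cell _ hπ, hst])
  refine ⟨ξ + ξ', ⟨?_, ?_⟩, ?_⟩
  · rw [Measure.map_add _ _ measurable_fst, h1', h1]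
  · rw [Measure.map_add _ _ measurable_snd, h2', h2]
  · rw [lintegral_add_measure]
    refine add_le_add h3 ((lintegral_le_of_cellwise hπ (G := G)
      (fun x y hxy => (hc x y hxy).trans le_self_add) h3').trans ?_)
    rw [h1', h2', lintegral_comp_withDensity_comp μ hπ, lintegral_comp_withDensity_comp ν hπ,
      two_mul, lintegral_comp_eq_tsum ν hπ]
    simp only [hst]
    gcongr <;> exact mul_le_of_le_one_left' (ht _)

end Cellwise

/-! ### Geometric sums over annuli and scales -/

section LatticeSums

theorem two_rpow_neg_le {x y : ℝ} (h : y ≤ x) : (2 : ℝ) ^ (-x) ≤ 2 ^ (-y) :=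
  Real.rpow_le_rpow_of_exponent_le one_le_two (neg_le_neg h)

theorem ofReal_two_rpow_add (x y : ℝ) : ENNReal.ofReal (2 ^ (-(x + y))) =
    ENNReal.ofReal (2 ^ (-x)) * ENNReal.ofReal (2 ^ (-y)) := by
  rw [← ENNReal.ofReal_mul (by positivity), ← Real.rpow_add two_pos, neg_add]

theorem ofReal_two_rpow_le {x y : ℝ} (h : y ≤ x) :
    ENNReal.ofReal (2 ^ (-x)) ≤ ENNReal.ofReal (2 ^ (-y)) :=
  ENNReal.ofReal_le_ofReal (two_rpow_neg_le h)

theorem exists_tsum_two_rpow_le {c : ℝ} (hc : 0 < c) :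
    ∃ C : ℝ, 0 < C ∧ ∑' j : ℕ, ENNReal.ofReal (2 ^ (-(c * j))) ≤ ENNReal.ofReal C := by
  have hr : (2 : ℝ) ^ (-c) < 1 := Real.rpow_lt_one_of_one_lt_of_neg one_lt_two (neg_lt_zero.2 hc)
  refine ⟨(1 - 2 ^ (-c))⁻¹, inv_pos.2 (sub_pos.2 hr), ?_⟩
  have e : ∀ j : ℕ, (2 : ℝ) ^ (-(c * j)) = (2 ^ (-c)) ^ j := fun j => by
    rw [← Real.rpow_mul_natCast two_pos.le, neg_mul]
  simp only [e]
  rw [← ENNReal.ofReal_tsum_of_nonneg (fun j => by positivity)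
    (summable_geometric_of_lt_one (by positivity) hr),
    tsum_geometric_of_lt_one (by positivity) hr]

theorem tsum_two_rpow_of_neg {c s : ℝ} {g : ℕ → ℝ} (hg : ∀ j : ℕ, g j = j - s) :
    ∑' j : ℕ, ENNReal.ofReal (2 ^ (-(c * g j))) =
      (∑' j : ℕ, ENNReal.ofReal (2 ^ (-(c * j)))) * ENNReal.ofReal (2 ^ (-(c * -s))) := by
  rw [← ENNReal.tsum_mul_right]
  refine tsum_congr fun j => ?_
  rw [← ofReal_two_rpow_add, hg]
  congr 3
  ring

theorem ENNReal_tsum_eq_sum_add (f : ℕ → ℝ≥0∞) (k : ℕ) :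
    ∑' j, f j = ∑ j ∈ Finset.range k, f j + ∑' j, f (j + k) :=
  ((ENNReal.summable (f := fun j => f (j + k))).sum_add_tsum_nat_add').symm

/-- Sums of a two-sided geometric profile centred at `s`. -/
theorem exists_tsum_abs_le {c : ℝ} (hc : 0 < c) :
    ∃ C : ℝ, 0 < C ∧ ∀ s : ℝ, ∑' j : ℕ, ENNReal.ofReal (2 ^ (-(c * |s - j|))) ≤
      ENNReal.ofReal (C * 2 ^ (-(c * max (-s) 0))) := by
  obtain ⟨C, hC, h⟩ := exists_tsum_two_rpow_le hc
  refine ⟨C + C, by positivity, fun s => ?_⟩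
  rw [ENNReal.ofReal_mul (by positivity), ENNReal.ofReal_add hC.le hC.le]
  rcases lt_or_ge s 0 with hs | hs
  · rw [tsum_two_rpow_of_neg (s := s) (fun j => by
      rw [abs_of_nonpos (by linarith [(Nat.cast_nonneg j : (0 : ℝ) ≤ j)])]; ring),
      max_eq_left (by linarith)]
    gcongr
    exact h.trans le_self_add
  · rw [max_eq_right (by linarith), mul_zero, neg_zero, Real.rpow_zero, ENNReal.ofReal_one, mul_one,
      ENNReal_tsum_eq_sum_add _ (⌊s⌋₊ + 1)]
    have h1 := Nat.floor_le hs
    have h2 := Nat.lt_floor_add_one s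
    refine add_le_add ?_ ?_
    · rw [← Finset.sum_range_reflect]
      refine (Finset.sum_le_sum fun i hi => ?_).trans ((ENNReal.sum_le_tsum _).trans h)
      have hi' : i ≤ ⌊s⌋₊ := Nat.lt_succ_iff.1 (Finset.mem_range.1 hi)
      refine ofReal_two_rpow_le (mul_le_mul_of_nonneg_left ?_ hc.le)
      rw [Nat.add_sub_cancel, Nat.cast_sub hi']
      exact le_trans (by linarith) (le_abs_self _)
    · refine (ENNReal.tsum_le_tsum fun i => ?_).trans h
      refine ofReal_two_rpow_le (mul_le_mul_of_nonneg_left ?_ hc.le)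
      push_cast
      exact le_trans (by linarith) (neg_le_abs _)

/-- Sums of a profile that is flat up to `s` and decays geometrically afterwards. -/
theorem exists_tsum_negPart_le {c : ℝ} (hc : 0 < c) :
    ∃ C : ℝ, 0 < C ∧ ∀ s : ℝ, ∑' j : ℕ, ENNReal.ofReal (2 ^ (-(c * max (-(s - j)) 0))) ≤
      ENNReal.ofReal ((max s 0 + C) * 2 ^ (-(c * max (-s) 0))) := by
  obtain ⟨C, hC, h⟩ := exists_tsum_two_rpow_le hc
  refine ⟨1 + C, by positivity, fun s => ?_⟩
  rw [ENNReal.ofReal_mul (by positivity)]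
  rcases lt_or_ge s 0 with hs | hs
  · rw [tsum_two_rpow_of_neg (s := s) (fun j => by
      rw [max_eq_left (by linarith [(Nat.cast_nonneg j : (0 : ℝ) ≤ j)])]; ring),
      max_eq_left (by linarith : (0 : ℝ) ≤ -s), max_eq_right hs.le]
    gcongr
    exact h.trans (ENNReal.ofReal_le_ofReal (by linarith))
  · rw [max_eq_right (by linarith : -s ≤ 0), mul_zero, neg_zero, Real.rpow_zero,
      ENNReal.ofReal_one, mul_one, max_eq_left hs, ← add_assoc,
      ENNReal.ofReal_add (by positivity) hC.le,
      ENNReal_tsum_eq_sum_add _ (⌊s⌋₊ + 1)]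
    have h1 := Nat.floor_le hs
    have h2 := Nat.lt_floor_add_one s
    refine add_le_add ?_ ?_
    · refine (Finset.sum_le_card_nsmul _ _ 1 fun i _ => ?_).trans ?_
      · rw [← ENNReal.ofReal_one]
        refine ENNReal.ofReal_le_ofReal (Real.rpow_le_one_of_one_le_of_nonpos one_le_two ?_)
        exact neg_nonpos.2 (mul_nonneg hc.le (le_max_right _ _))
      · rw [Finset.card_range, nsmul_one, ← ENNReal.ofReal_natCast]
        exact ENNReal.ofReal_le_ofReal (by push_cast; linarith)
    · refine (ENNReal.tsum_le_tsum fun i => ?_).trans h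
      refine ofReal_two_rpow_le (mul_le_mul_of_nonneg_left ?_ hc.le)
      push_cast
      exact le_trans (by linarith) (le_max_left _ _)

/-- Interpolation between the two branches. The two hypotheses leave room for an extra decay in |t|:
one serves t ≤ 0, the other t ≥ 0. -/
theorem min_one_two_rpow_le_abs {θ e t : ℝ} (h0 : 2 * e ≤ θ) (h1 : θ + 2 * e ≤ 1) :
    min 1 ((2 : ℝ) ^ (-(t / 2))) ≤ 2 ^ (-(θ * t / 2 + e * |t|)) := by
  rcases le_total 0 t with ht | ht
  · refine (min_le_right _ _).trans (two_rpow_neg_le ?_)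
    rw [abs_of_nonneg ht]
    nlinarith
  · refine (min_le_left _ _).trans (Real.one_le_rpow one_le_two ?_)
    rw [abs_of_nonpos ht]
    nlinarith

/-- The endpoint θ = 1: the branch t ≥ 0 is already sharp, so extra decay survives only for t < 0.
-/
theorem min_one_two_rpow_le_negPart {e t : ℝ} (h0 : 2 * e ≤ 1) :
    min 1 ((2 : ℝ) ^ (-(t / 2))) ≤ 2 ^ (-(t / 2 + e * max (-t) 0)) := by
  rcases le_total 0 t with ht | ht
  · refine (min_le_right _ _).trans (two_rpow_neg_le ?_)
    rw [max_eq_right (by linarith)]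
    linarith
  · refine (min_le_left _ _).trans (Real.one_le_rpow one_le_two ?_)
    rw [max_eq_left (by linarith)]
    nlinarith

/-- The double sum over annuli and scales, with a weight `g` of the distance to the critical
line. -/
noncomputable def latticeSum (g : ℝ → ℝ) (a b u v e N : ℝ) : ℝ≥0∞ :=
  ∑' (m : ℕ) (j : ℕ), ENNReal.ofReal (2 ^ (-(a * m + b * j + e * g (N - u * m - v * j))))

theorem latticeSum_swap (g : ℝ → ℝ) (a b u v e N : ℝ) :
    latticeSum g a b u v e N = latticeSum g b a v u e N := by
  unfold latticeSum
  rw [ENNReal.tsum_comm]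
  refine tsum_congr fun m => tsum_congr fun j => ?_
  rw [add_comm (a * (j : ℝ)), sub_right_comm]

theorem tsum_abs_scale_eq (e w : ℝ) {v : ℝ} (hv : 0 < v) :
    ∑' j : ℕ, ENNReal.ofReal (2 ^ (-(e * |w - v * j|))) =
      ∑' j : ℕ, ENNReal.ofReal (2 ^ (-(e * v * |w / v - j|))) := by
  refine tsum_congr fun j => ?_
  rw [mul_assoc, ← abs_of_pos hv, ← abs_mul, abs_of_pos hv, mul_sub, mul_div_cancel₀ _ hv.ne']

theorem tsum_negPart_scale_eq (e w : ℝ) {v : ℝ} (hv : 0 < v) :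
    ∑' j : ℕ, ENNReal.ofReal (2 ^ (-(e * max (-(w - v * j)) 0))) =
      ∑' j : ℕ, ENNReal.ofReal (2 ^ (-(e * v * max (-(w / v - j)) 0))) := by
  refine tsum_congr fun j => ?_
  rw [mul_assoc, mul_max_of_nonneg _ _ hv.le, mul_zero, mul_neg, mul_sub,
    mul_div_cancel₀ _ hv.ne']

theorem scale_negPart (e w : ℝ) {v : ℝ} (hv : 0 < v) :
    e * v * max (-(w / v)) 0 = e * max (-w) 0 := by
  rw [mul_assoc, mul_max_of_nonneg _ _ hv.le, mul_zero, mul_neg, mul_div_cancel₀ _ hv.ne']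

/-- The inner profile in j is centred at (N - um)/v with rate ev, so its sum is bounded wherever the
centre lies; the outer sum converges at rate a₀. The constant sees only a₀ and ev = c, which permits
v = d → ∞ with e of order 1/d. -/
theorem exists_latticeSum_abs_le {c a₀ : ℝ} (hc : 0 < c) (ha : 0 < a₀) :
    ∃ C : ℝ, 0 < C ∧ ∀ a b u v e N : ℝ, a₀ ≤ a → 0 ≤ b → 0 < v → e * v = c →
      latticeSum (fun t => |t|) a b u v e N ≤ ENNReal.ofReal C := by
  obtain ⟨C₁, hC₁, h₁⟩ := exists_tsum_two_rpow_le ha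
  obtain ⟨C₂, hC₂, h₂⟩ := exists_tsum_abs_le hc
  refine ⟨C₁ * C₂, by positivity, fun a b u v e N haa hb hv he => ?_⟩
  rw [ENNReal.ofReal_mul hC₁.le]
  calc latticeSum (fun t => |t|) a b u v e N
      ≤ ∑' (m : ℕ), ENNReal.ofReal (2 ^ (-(a₀ * m))) * ENNReal.ofReal C₂ := by
        refine ENNReal.tsum_le_tsum fun m => ?_
        calc _ ≤ ∑' j : ℕ, ENNReal.ofReal (2 ^ (-(a₀ * m))) *
              ENNReal.ofReal (2 ^ (-(e * |N - u * m - v * j|))) := by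
              refine ENNReal.tsum_le_tsum fun j => ?_
              rw [← ofReal_two_rpow_add]
              refine ofReal_two_rpow_le ?_
              have := mul_le_mul_of_nonneg_right haa (Nat.cast_nonneg (α := ℝ) m)
              have := mul_nonneg hb (Nat.cast_nonneg (α := ℝ) j)
              linarith
          _ ≤ _ := by
              rw [ENNReal.tsum_mul_left, tsum_abs_scale_eq _ _ hv, he]
              gcongr
              refine (h₂ _).trans (ENNReal.ofReal_le_ofReal ?_)
              refine mul_le_of_le_one_right hC₂.le ?_
              exact Real.rpow_le_one_of_one_le_of_nonpos one_le_two
                (neg_nonpos.2 (mul_nonneg hc.le (le_max_right _ _)))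
    _ ≤ _ := by
        rw [ENNReal.tsum_mul_right]
        gcongr

/-- Without other damping, each m with um ≤ N contributes a bounded amount and later ones decay
geometrically, so about N/u values of m count. -/
theorem exists_latticeSum_abs_le_log {e u v : ℝ} (he : 0 < e) (hu : 0 < u) (hv : 0 < v) :
    ∃ C : ℝ, 0 < C ∧ ∀ N : ℝ, 0 ≤ N →
      latticeSum (fun t => |t|) 0 0 u v e N ≤ ENNReal.ofReal (C * (1 + N)) := by
  obtain ⟨C₁, hC₁, h₁⟩ := exists_tsum_abs_le (mul_pos he hv)
  obtain ⟨C₂, hC₂, h₂⟩ := exists_tsum_negPart_le (mul_pos he hu)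
  refine ⟨C₁ * (u⁻¹ + C₂), by positivity, fun N hN => ?_⟩
  calc latticeSum (fun t => |t|) 0 0 u v e N
      ≤ ∑' (m : ℕ), ENNReal.ofReal C₁ *
          ENNReal.ofReal (2 ^ (-(e * u * max (-(N / u - m)) 0))) := by
        refine ENNReal.tsum_le_tsum fun m => ?_
        simp only [zero_mul, zero_add]
        rw [tsum_abs_scale_eq _ _ hv]
        refine (h₁ _).trans (le_of_eq ?_)
        rw [← ENNReal.ofReal_mul hC₁.le, scale_negPart _ _ hv, mul_assoc e u,
          mul_max_of_nonneg _ _ hu.le, mul_zero, mul_neg, mul_sub, mul_div_cancel₀ _ hu.ne']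
    _ ≤ _ := by
        rw [ENNReal.tsum_mul_left, mul_assoc, ENNReal.ofReal_mul hC₁.le]
        gcongr
        refine (h₂ _).trans (ENNReal.ofReal_le_ofReal ?_)
        have hNu : 0 ≤ N / u := by positivity
        rw [max_eq_left hNu, max_eq_right (by linarith), mul_zero, neg_zero, Real.rpow_zero,
          mul_one, div_eq_inv_mul]
        have : 0 < u⁻¹ := by positivity
        nlinarith

theorem latticeSum_negPart_le_of_pos {a b : ℝ} (ha : 0 < a) (hb : 0 < b) {e : ℝ} (he : 0 < e)
    (u v : ℝ) : ∃ C : ℝ, 0 < C ∧ ∀ N : ℝ,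
      latticeSum (fun t => max (-t) 0) a b u v e N ≤ ENNReal.ofReal C := by
  obtain ⟨C₁, hC₁, h₁⟩ := exists_tsum_two_rpow_le ha
  obtain ⟨C₂, hC₂, h₂⟩ := exists_tsum_two_rpow_le hb
  refine ⟨C₁ * C₂, by positivity, fun N => ?_⟩
  rw [ENNReal.ofReal_mul hC₁.le]
  calc latticeSum (fun t => max (-t) 0) a b u v e N
      ≤ ∑' (m : ℕ) (j : ℕ), ENNReal.ofReal (2 ^ (-(a * m))) * ENNReal.ofReal (2 ^ (-(b * j))) := by
        refine ENNReal.tsum_le_tsum fun m => ENNReal.tsum_le_tsum fun j => ?_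
        rw [← ofReal_two_rpow_add]
        refine ofReal_two_rpow_le ?_
        have := mul_nonneg he.le (le_max_right (-(N - u * m - v * j)) 0)
        linarith
    _ ≤ _ := by
        simp only [ENNReal.tsum_mul_left, ENNReal.tsum_mul_right]
        gcongr

theorem tsum_negPart_scale_le {e v C w : ℝ} (hv : 0 < v)
    (h : ∀ s : ℝ, ∑' j : ℕ, ENNReal.ofReal (2 ^ (-(e * v * max (-(s - j)) 0))) ≤
      ENNReal.ofReal ((max s 0 + C) * 2 ^ (-(e * v * max (-s) 0)))) {N : ℝ} (hN : 0 ≤ N)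
    (hw : w ≤ N) :
    ∑' j : ℕ, ENNReal.ofReal (2 ^ (-(e * max (-(w - v * j)) 0))) ≤
      ENNReal.ofReal ((v⁻¹ * N + C) * 2 ^ (-(e * max (-w) 0))) := by
  rw [tsum_negPart_scale_eq _ _ hv]
  refine (h _).trans (ENNReal.ofReal_le_ofReal ?_)
  rw [scale_negPart _ _ hv, ← div_eq_inv_mul]
  gcongr
  exact max_le (by gcongr) (by positivity)

/-- The one-sided weight is flat over about N/v scales j, which produces the logarithm; the sum over
m converges by itself. -/
theorem exists_latticeSum_negPart_le_log {e u v a : ℝ} (he : 0 < e) (hu : 0 < u) (hv : 0 < v)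
    (ha : 0 < a) :
    ∃ C : ℝ, 0 < C ∧ ∀ N : ℝ, 0 ≤ N →
      latticeSum (fun t => max (-t) 0) a 0 u v e N ≤ ENNReal.ofReal (C * (1 + N)) := by
  obtain ⟨C₁, hC₁, h₁⟩ := exists_tsum_two_rpow_le ha
  obtain ⟨C₂, hC₂, h₂⟩ := exists_tsum_negPart_le (mul_pos he hv)
  refine ⟨C₁ * (v⁻¹ + C₂), by positivity, fun N hN => ?_⟩
  have hv' : 0 < v⁻¹ := by positivity
  calc latticeSum (fun t => max (-t) 0) a 0 u v e N
      ≤ ∑' (m : ℕ), ENNReal.ofReal (2 ^ (-(a * m))) * ENNReal.ofReal (v⁻¹ * N + C₂) := by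
        refine ENNReal.tsum_le_tsum fun m => ?_
        simp only [zero_mul, add_zero, ofReal_two_rpow_add]
        rw [ENNReal.tsum_mul_left]
        gcongr
        refine (tsum_negPart_scale_le hv h₂ hN (w := N - u * m) (by
          have := mul_nonneg hu.le (Nat.cast_nonneg (α := ℝ) m)
          linarith)).trans (ENNReal.ofReal_le_ofReal ?_)
        refine mul_le_of_le_one_right (by positivity) ?_
        exact Real.rpow_le_one_of_one_le_of_nonpos one_le_two
          (neg_nonpos.2 (mul_nonneg he.le (le_max_right _ _)))
    _ ≤ ENNReal.ofReal C₁ * ENNReal.ofReal (v⁻¹ * N + C₂) := by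
        rw [ENNReal.tsum_mul_right]
        gcongr
    _ ≤ _ := by
        rw [← ENNReal.ofReal_mul hC₁.le, mul_assoc]
        refine ENNReal.ofReal_le_ofReal ?_
        gcongr
        nlinarith

/-- The undamped terms fill the triangle um + vj ≤ N, whose number of lattice points is quadratic in
N. -/
theorem exists_latticeSum_negPart_le_log_sq {e u v : ℝ} (he : 0 < e) (hu : 0 < u) (hv : 0 < v) :
    ∃ C : ℝ, 0 < C ∧ ∀ N : ℝ, 0 ≤ N →
      latticeSum (fun t => max (-t) 0) 0 0 u v e N ≤ ENNReal.ofReal (C * (1 + N) ^ 2) := by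
  obtain ⟨C₁, hC₁, h₁⟩ := exists_tsum_negPart_le (mul_pos he hu)
  obtain ⟨C₂, hC₂, h₂⟩ := exists_tsum_negPart_le (mul_pos he hv)
  refine ⟨(v⁻¹ + C₂) * (u⁻¹ + C₁), by positivity, fun N hN => ?_⟩
  have hv' : 0 < v⁻¹ := by positivity
  have hu' : 0 < u⁻¹ := by positivity
  calc latticeSum (fun t => max (-t) 0) 0 0 u v e N
      ≤ ∑' (m : ℕ), ENNReal.ofReal (v⁻¹ * N + C₂) *
          ENNReal.ofReal (2 ^ (-(e * max (-(N - u * m)) 0))) := by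
        refine ENNReal.tsum_le_tsum fun m => ?_
        simp only [zero_mul, zero_add]
        rw [← ENNReal.ofReal_mul (by positivity)]
        exact tsum_negPart_scale_le hv h₂ hN (by
          have := mul_nonneg hu.le (Nat.cast_nonneg (α := ℝ) m)
          linarith)
    _ ≤ ENNReal.ofReal (v⁻¹ * N + C₂) * ENNReal.ofReal (u⁻¹ * N + C₁) := by
        rw [ENNReal.tsum_mul_left]
        gcongr
        refine (tsum_negPart_scale_le hu h₁ hN le_rfl).trans (le_of_eq ?_)
        rw [max_eq_right (by linarith : -N ≤ 0), mul_zero, neg_zero, Real.rpow_zero, mul_one]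
    _ ≤ _ := by
        rw [← ENNReal.ofReal_mul (by positivity)]
        refine ENNReal.ofReal_le_ofReal ?_
        calc (v⁻¹ * N + C₂) * (u⁻¹ * N + C₁)
            ≤ ((v⁻¹ + C₂) * (1 + N)) * ((u⁻¹ + C₁) * (1 + N)) := by
              gcongr <;> nlinarith
          _ = _ := by ring

end LatticeSums

/-! ### Rates and logarithms from the double sum -/

section RateSums

/-- The sum over annuli `m` and scales `j` of the expected transport costs, with `2 ^ N` sample
points. -/
noncomputable def scaleSum (p q : ℝ) (d : ℕ) (N : ℝ) : ℝ≥0∞ :=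
  ∑' (m : ℕ) (j : ℕ), ENNReal.ofReal (2 ^ (-((q - p) * m + p * j)) *
    min 1 (2 ^ (-((N - q * m - d * j) / 2))))

theorem scaleSum_le_of_forall {p q : ℝ} {d : ℕ} {N θ e : ℝ} {g : ℝ → ℝ}
    (h : ∀ t : ℝ, min 1 ((2 : ℝ) ^ (-(t / 2))) ≤ 2 ^ (-(θ * t / 2 + e * g t))) :
    scaleSum p q d N ≤ ENNReal.ofReal (2 ^ (-(θ / 2 * N))) *
      latticeSum g (q - p - θ * q / 2) (p - θ * d / 2) q d e N := by
  unfold scaleSum latticeSum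
  rw [← ENNReal.tsum_mul_left]
  refine ENNReal.tsum_le_tsum fun m => ?_
  rw [← ENNReal.tsum_mul_left]
  refine ENNReal.tsum_le_tsum fun j => ?_
  rw [← ofReal_two_rpow_add]
  refine ENNReal.ofReal_le_ofReal ((mul_le_mul_of_nonneg_left (h _) (by positivity)).trans
    (le_of_eq ?_))
  rw [← Real.rpow_add two_pos]
  congr 1
  ring

theorem scaleSum_le_abs {p q : ℝ} {d : ℕ} {N θ e C : ℝ} (h0 : 2 * e ≤ θ) (h1 : θ + 2 * e ≤ 1)
    (h : latticeSum (fun t => |t|) (q - p - θ * q / 2) (p - θ * d / 2) q d e N ≤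
      ENNReal.ofReal C) :
    scaleSum p q d N ≤ ENNReal.ofReal (C * 2 ^ (-(θ / 2 * N))) := by
  refine (scaleSum_le_of_forall fun t => min_one_two_rpow_le_abs h0 h1).trans ?_
  rw [mul_comm C, ENNReal.ofReal_mul (by positivity)]
  gcongr

theorem scaleSum_le_negPart {p q : ℝ} {d : ℕ} {N C : ℝ}
    (h : latticeSum (fun t => max (-t) 0) (q / 2 - p) (p - d / 2) q d (1 / 2) N ≤
      ENNReal.ofReal C) :
    scaleSum p q d N ≤ ENNReal.ofReal (C * 2 ^ (-(1 / 2 * N))) := by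
  refine (scaleSum_le_of_forall (θ := 1) (e := 1 / 2) (g := fun t => max (-t) 0) fun t => by
    simpa only [one_mul] using min_one_two_rpow_le_negPart (e := 1 / 2) (t := t)
      (by norm_num)).trans ?_
  rw [mul_comm C, ENNReal.ofReal_mul (by positivity)]
  gcongr
  rwa [one_mul, one_mul, show q - p - q / 2 = q / 2 - p by ring]

theorem logExponent_nonneg (p q : ℝ) (d : ℕ) : 0 ≤ logExponent p q d := by
  unfold logExponent; split_ifs <;> norm_num

/-- For exponent 0 the factor is 1 even at N = 0, as `0 ^ 0 = 1`; only a genuine logarithm needs N ≥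
1. -/
theorem one_le_rpow_logExponent {p q : ℝ} {d : ℕ} {N : ℝ}
    (h : logExponent p q d ≠ 0 → 1 ≤ N) : 1 ≤ N ^ logExponent p q d := by
  by_cases h0 : logExponent p q d = 0
  · rw [h0, Real.rpow_zero]
  · exact Real.one_le_rpow (h h0) (logExponent_nonneg p q d)

/-- The rate of `W_p ^ p`, as a minimum of quotients. -/
theorem mul_rateExponent_eq {p q : ℝ} (hp : 1 ≤ p) (hpq : p < q) (d : ℕ) :
    p * rateExponent p q d = min (p / max (2 * p) d) ((q - p) / q) := by
  have hp0 : 0 < p := by linarith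
  have hq0 : 0 < q := by linarith
  rw [rateExponent, mul_min_of_nonneg _ _ hp0.le]
  congr 1
  · ring
  · field_simp

/-- The bound of the double sum for one dimension. -/
theorem exists_scaleSum_le {p q : ℝ} (hp : 1 ≤ p) (hpq : p < q) {d : ℕ} (hd : 1 ≤ d) :
    ∃ C : ℝ, 0 < C ∧ ∀ N : ℝ, 0 ≤ N → (logExponent p q d ≠ 0 → 1 ≤ N) →
      scaleSum p q d N ≤
        ENNReal.ofReal (C * 2 ^ (-(p * rateExponent p q d * N)) * N ^ logExponent p q d) := by
  have hp0 : 0 < p := by linarith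
  have hq0 : 0 < q := by linarith
  have hd0 : (0 : ℝ) < d := by exact_mod_cast hd
  have hm0 : 0 < max (2 * p) (d : ℝ) := lt_max_of_lt_right hd0
  obtain ⟨θ, hθ⟩ : ∃ θ, θ / 2 = p * rateExponent p q d := ⟨2 * (p * rateExponent p q d), by ring⟩
  rw [← hθ]
  rw [mul_rateExponent_eq hp hpq] at hθ
  have h1 : θ / 2 ≤ p / max (2 * p) d := hθ ▸ min_le_left _ _
  have h2 : θ / 2 ≤ (q - p) / q := hθ ▸ min_le_right _ _
  have hθ0 : 0 < θ := by
    have : 0 < θ / 2 := by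
      rw [hθ]; exact lt_min (by positivity) (div_pos (by linarith) hq0)
    linarith
  rw [le_div_iff₀ hm0] at h1
  rw [le_div_iff₀ hq0] at h2
  have hθ1 : θ ≤ 1 := by
    have := mul_le_mul_of_nonneg_left (le_max_left (2 * p) (d : ℝ)) hθ0.le
    nlinarith
  -- These are the decay rates in m and j left after extracting 2^(-θN/2). Which of them vanish, and
  -- whether θ = 1, decides the logarithm.
  have ha : 0 ≤ q - p - θ * q / 2 := by linarith
  have hb : 0 ≤ p - θ * d / 2 := by
    have := mul_le_mul_of_nonneg_left (le_max_right (2 * p) (d : ℝ)) hθ0.le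
    linarith
  have const : ∀ C : ℝ, 0 < C → (∀ N : ℝ, scaleSum p q d N ≤
      ENNReal.ofReal (C * 2 ^ (-(θ / 2 * N)))) → ∃ C : ℝ, 0 < C ∧ ∀ N : ℝ, 0 ≤ N →
      (logExponent p q d ≠ 0 → 1 ≤ N) → scaleSum p q d N ≤
        ENNReal.ofReal (C * 2 ^ (-(θ / 2 * N)) * N ^ logExponent p q d) := fun C hC h =>
    ⟨C, hC, fun N _ hN1 => (h N).trans (ENNReal.ofReal_le_ofReal
      (le_mul_of_one_le_right (by positivity) (one_le_rpow_logExponent hN1)))⟩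
  have log1 : logExponent p q d = 1 → ∀ C : ℝ, 0 < C → (∀ N : ℝ, 0 ≤ N → scaleSum p q d N ≤
      ENNReal.ofReal (C * (1 + N) * 2 ^ (-(θ / 2 * N)))) → ∃ C : ℝ, 0 < C ∧ ∀ N : ℝ, 0 ≤ N →
      (logExponent p q d ≠ 0 → 1 ≤ N) → scaleSum p q d N ≤
        ENNReal.ofReal (C * 2 ^ (-(θ / 2 * N)) * N ^ logExponent p q d) := by
    intro hl C hC h
    refine ⟨C * 2, by positivity, fun N hN hN1 => (h N hN).trans (ENNReal.ofReal_le_ofReal ?_)⟩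
    have : 1 ≤ N := hN1 (by rw [hl]; exact one_ne_zero)
    rw [hl, Real.rpow_one, mul_right_comm _ _ N, mul_assoc C 2 N]
    gcongr
    linarith
  rcases hθ1.lt_or_eq with hlt | heq
  · set e := min (θ / 2) ((1 - θ) / 2) with he
    have he0 : 0 < e := lt_min (by linarith) (by linarith)
    have he1 : 2 * e ≤ θ := by linarith [min_le_left (θ / 2) ((1 - θ) / 2)]
    have he2 : θ + 2 * e ≤ 1 := by linarith [min_le_right (θ / 2) ((1 - θ) / 2)]
    rcases ha.lt_or_eq with ha' | ha'
    · obtain ⟨C, hC, h⟩ := exists_latticeSum_abs_le (mul_pos he0 hd0) ha'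
      exact const C hC fun N => scaleSum_le_abs he1 he2 (h _ _ _ _ _ _ le_rfl hb hd0 rfl)
    rcases hb.lt_or_eq with hb' | hb'
    · obtain ⟨C, hC, h⟩ := exists_latticeSum_abs_le (mul_pos he0 hq0) hb'
      refine const C hC fun N => scaleSum_le_abs he1 he2 ?_
      rw [latticeSum_swap]
      exact h _ _ _ _ _ _ le_rfl ha hq0 rfl
    · obtain ⟨C, hC, h⟩ := exists_latticeSum_abs_le_log he0 hq0 hd0
      have hd2 : 2 * p < d := by nlinarith
      have hcrit : q = criticalMoment p d := by
        have hdp : 0 < (d : ℝ) - p := by linarith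
        -- Both rates vanish: eliminating θ from θd = 2p and θq = 2(q - p) gives q = dp/(d - p).
        have e1 : q * (d - p) = d * p := by
          have e2 : θ * d = 2 * p := by linarith
          have e3 : θ * q = 2 * (q - p) := by linarith
          have e4 : q * (θ * d) = d * (θ * q) := by ring
          rw [e2, e3] at e4
          linarith
        rw [criticalMoment, if_neg (by linarith), ← e1, mul_div_cancel_right₀ _ hdp.ne',
          min_eq_left]
        nlinarith
      refine log1 ?_ C hC fun N hN => scaleSum_le_abs he1 he2 ?_
      · rw [logExponent, if_neg (fun h => hd2.ne' h.1), if_pos (Or.inl ⟨hd2.ne', hcrit⟩)]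
      · rw [← ha', ← hb']
        exact h N hN
  · subst heq
    have ha : 0 ≤ q / 2 - p := by linarith
    have hb : 0 ≤ p - (d : ℝ) / 2 := by linarith
    rcases ha.lt_or_eq with ha' | ha' <;> rcases hb.lt_or_eq with hb' | hb'
    · obtain ⟨C, hC, h⟩ := latticeSum_negPart_le_of_pos ha' hb' (e := 1 / 2) (by norm_num) q d
      exact const C hC fun N => scaleSum_le_negPart (h N)
    · obtain ⟨C, hC, h⟩ := exists_latticeSum_negPart_le_log (e := 1 / 2) (by norm_num) hq0 hd0 ha'
      have hd2 : (d : ℝ) = 2 * p := by linarith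
      refine log1 ?_ C hC fun N hN => scaleSum_le_negPart ?_
      · rw [logExponent, if_neg (fun h => by linarith [h.2]),
          if_pos (Or.inr ⟨hd2, by linarith⟩)]
      · rw [← hb']
        exact h N hN
    · obtain ⟨C, hC, h⟩ := exists_latticeSum_negPart_le_log (e := 1 / 2) (by norm_num) hd0 hq0 hb'
      have hd2 : (d : ℝ) ≠ 2 * p := by linarith
      have hcrit : q = criticalMoment p d := by
        rw [criticalMoment]
        split_ifs with hdp
        · linarith
        · have : 2 * p ≤ d * p / (d - p) := by
            rw [le_div_iff₀ (by linarith)]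
            nlinarith
          rw [min_eq_right this]
          linarith
      refine log1 ?_ C hC fun N hN => scaleSum_le_negPart ?_
      · rw [logExponent, if_neg (fun h => hd2 h.1), if_pos (Or.inl ⟨hd2, hcrit⟩)]
      · rw [latticeSum_swap, ← ha']
        exact h N hN
    · obtain ⟨C, hC, h⟩ := exists_latticeSum_negPart_le_log_sq (e := 1 / 2) (by norm_num) hq0 hd0
      have hl : logExponent p q d = 2 := by
        rw [logExponent, if_pos ⟨by linarith, by linarith⟩]
      refine ⟨C * 4, by positivity, fun N hN hN1 => (scaleSum_le_negPart (C := C * (1 + N) ^ 2) ?_).trans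
        (ENNReal.ofReal_le_ofReal ?_)⟩
      · rw [← ha', ← hb']
        exact h N hN
      · have : 1 ≤ N := hN1 (by rw [hl]; exact two_ne_zero)
        rw [hl, Real.rpow_two, mul_right_comm _ _ (N ^ 2), mul_assoc C 4]
        gcongr
        nlinarith

/-- The bound of the double sum, uniformly in large dimensions. -/
theorem exists_scaleSum_le_of_large {p q : ℝ} (hp : 1 ≤ p) (hpq : p < q) :
    ∃ (D : ℕ) (C : ℝ), 0 < C ∧ ∀ d : ℕ, D ≤ d → ∀ N : ℝ, 0 ≤ N →
      (logExponent p q d ≠ 0 → 1 ≤ N) → scaleSum p q d N ≤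
        ENNReal.ofReal (C * 2 ^ (-(p * rateExponent p q d * N)) * N ^ logExponent p q d) := by
  have hp0 : 0 < p := by linarith
  have hq0 : 0 < q := by linarith
  obtain ⟨C, hC, h⟩ := exists_latticeSum_abs_le (c := p / 2) (a₀ := (q - p) / 2) (by linarith)
    (by linarith)
  -- For d ≥ 3p the choice θ = 2p/d, e = p/(2d) satisfies θ + 2e ≤ 1. The other bound keeps the rate
  -- in m at least (q - p)/2. As ed = p/2, the lattice bound does not depend on d.
  obtain ⟨D, hD⟩ := exists_nat_ge (max (3 * p) (2 * p * q / (q - p)))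
  refine ⟨D, C, hC, fun d hd N hN hN1 => ?_⟩
  have hDd : (D : ℝ) ≤ d := by exact_mod_cast hd
  have hd1 : 3 * p ≤ d := (le_max_left _ _).trans (hD.trans hDd)
  have hd2 : 2 * p * q / (q - p) ≤ d := (le_max_right _ _).trans (hD.trans hDd)
  have hd0 : (0 : ℝ) < d := by linarith
  rw [div_le_iff₀ (by linarith)] at hd2
  have hpd : p / d ≤ (q - p) / (2 * q) := by
    rw [div_le_div_iff₀ hd0 (by linarith)]; linarith
  have hrate : p * rateExponent p q d = p / d := by
    rw [mul_rateExponent_eq hp hpq, max_eq_right (by linarith), min_eq_left]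
    refine hpd.trans ?_
    gcongr
    linarith
  rw [hrate]
  have hd3 : p / d ≤ 1 / 3 := by
    rw [div_le_div_iff₀ hd0 (by norm_num)]; linarith
  refine (scaleSum_le_abs (θ := 2 * p / d) (e := p / d / 2) (C := C) ?_ ?_ ?_).trans
    (ENNReal.ofReal_le_ofReal ?_)
  · rw [mul_div_assoc]; linarith [div_pos hp0 hd0]
  · rw [mul_div_assoc]; linarith
  · refine h _ _ _ _ _ _ ?_ ?_ hd0 ?_
    · have : p / d * q ≤ (q - p) / 2 := by
        calc p / d * q ≤ (q - p) / (2 * q) * q := by gcongr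
          _ = (q - p) / 2 := by field_simp
      calc (q - p) / 2 ≤ q - p - p / d * q := by linarith
        _ = _ := by ring
    · rw [div_mul_cancel₀ _ hd0.ne']; linarith
    · field_simp
  · rw [show 2 * p / d / 2 = p / d by ring]
    exact le_mul_of_one_le_right (by positivity) (one_le_rpow_logExponent hN1)

theorem exists_scaleSum_le_uniform {p q : ℝ} (hp : 1 ≤ p) (hpq : p < q) :
    ∃ C : ℝ, 0 < C ∧ ∀ d : ℕ, 1 ≤ d → ∀ N : ℝ, 0 ≤ N →
      (logExponent p q d ≠ 0 → 1 ≤ N) → scaleSum p q d N ≤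
        ENNReal.ofReal (C * 2 ^ (-(p * rateExponent p q d * N)) * N ^ logExponent p q d) := by
  obtain ⟨D, C, hC, h⟩ := exists_scaleSum_le_of_large hp hpq
  have h' : ∀ d : ℕ, ∃ c : ℝ, 0 < c ∧ (1 ≤ d → ∀ N : ℝ, 0 ≤ N →
      (logExponent p q d ≠ 0 → 1 ≤ N) → scaleSum p q d N ≤
        ENNReal.ofReal (c * 2 ^ (-(p * rateExponent p q d * N)) * N ^ logExponent p q d)) := by
    intro d
    by_cases hd : 1 ≤ d
    · obtain ⟨c, hc, h⟩ := exists_scaleSum_le hp hpq hd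
      exact ⟨c, hc, fun _ => h⟩
    · exact ⟨1, one_pos, fun h => absurd h hd⟩
  choose c hc hc' using h'
  have hsum : 0 ≤ ∑ d ∈ Finset.range D, c d := Finset.sum_nonneg fun d _ => (hc d).le
  refine ⟨C + ∑ d ∈ Finset.range D, c d, by linarith, fun d hd N hN hN1 => ?_⟩
  rcases lt_or_ge d D with hlt | hge
  · refine (hc' d hd N hN hN1).trans (ENNReal.ofReal_le_ofReal ?_)
    gcongr
    linarith [Finset.single_le_sum (fun i _ => (hc i).le) (Finset.mem_range.2 hlt)]
  · refine (h d hge N hN hN1).trans (ENNReal.ofReal_le_ofReal ?_)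
    gcongr
    linarith

end RateSums

/-! ### Nested grids on dyadic annuli and the multiscale bound -/

section Grid

/-- The dyadic annulus, in units of `r`, that contains `x`. -/
noncomputable def annulus {E : Type*} [NormedAddCommGroup E] (r : ℝ) (x : E) : ℕ :=
  Nat.clog 2 ⌈‖x‖ / r⌉₊

theorem norm_le_annulus {E : Type*} [NormedAddCommGroup E] {r : ℝ} (hr : 0 < r) (x : E) :
    ‖x‖ ≤ r * 2 ^ annulus r x := by
  have h := Nat.le_pow_clog one_lt_two ⌈‖x‖ / r⌉₊
  have h' := Nat.ceil_le.1 h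
  push_cast at h'
  rw [div_le_iff₀ hr] at h'
  rw [mul_comm]
  exact h'

theorem lt_norm_of_annulus_eq {E : Type*} [NormedAddCommGroup E] {r : ℝ} (hr : 0 < r) {x : E}
    {m : ℕ} (h : annulus r x = m + 1) : r * 2 ^ m < ‖x‖ := by
  by_contra hlt
  rw [not_lt] at hlt
  have : annulus r x ≤ m := by
    rw [annulus, Nat.clog_le_iff_le_pow one_lt_two, Nat.ceil_le]
    push_cast
    rw [div_le_iff₀ hr, mul_comm]
    exact hlt
  omega

theorem measurable_annulus {E : Type*} [NormedAddCommGroup E] [MeasurableSpace E]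
    [OpensMeasurableSpace E] (r : ℝ) : Measurable (annulus r : E → ℕ) :=
  (Measurable.of_discrete (f := Nat.clog 2)).comp
    (Nat.measurable_ceil.comp (measurable_norm.div_const r))

variable {d : ℕ}

/-- The cell of `x` at level `l`: its annulus, of outer radius `r 2 ^ m`, and its cube, of diameter
`r 2 ^ (m - l)`, of a grid. -/
noncomputable def gridCell (r : ℝ) (l : ℕ) (x : EuclideanSpace ℝ (Fin d)) : ℕ × (Fin d → ℤ) :=
  (annulus r x, fun i => ⌊√d * 2 ^ l / (r * 2 ^ annulus r x) * x i⌋)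

/-- The cell of the previous level that contains a given one. -/
def parentCell (c : ℕ × (Fin d → ℤ)) : ℕ × (Fin d → ℤ) := (c.1, fun i => c.2 i / 2)

/-- The grids are nested: halving the floor of 2y gives the floor of y, and the annulus is the same
at all levels. -/
theorem parentCell_gridCell (r : ℝ) (l : ℕ) (x : EuclideanSpace ℝ (Fin d)) :
    parentCell (gridCell r (l + 1) x) = gridCell r l x := by
  refine Prod.ext rfl (funext fun i => ?_)
  have h := Int.floor_div_natCast (√d * 2 ^ (l + 1) / (r * 2 ^ annulus r x) * x i) 2
  simp only [parentCell, gridCell]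
  rw [show (2 : ℤ) = ((2 : ℕ) : ℤ) from rfl, ← h]
  congr 1
  push_cast
  ring

theorem measurable_gridCell (r : ℝ) (l : ℕ) :
    Measurable (gridCell r l : EuclideanSpace ℝ (Fin d) → ℕ × (Fin d → ℤ)) := by
  refine (measurable_annulus r).prodMk (measurable_pi_iff.2 fun i => ?_)
  refine Int.measurable_floor.comp (Measurable.mul ?_ ?_)
  · exact (Measurable.of_discrete (f := fun m : ℕ => √d * 2 ^ l / (r * 2 ^ m))).comp
      (measurable_annulus r)
  · fun_prop

theorem norm_sub_le_of_gridCell_eq (hd : 1 ≤ d) {r : ℝ} (hr : 0 < r) {l : ℕ}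
    {x y : EuclideanSpace ℝ (Fin d)} (h : gridCell r l x = gridCell r l y) :
    ‖x - y‖ ≤ r * 2 ^ annulus r x / 2 ^ l := by
  have hd0 : (0 : ℝ) < d := by exact_mod_cast hd
  have hs : 0 < √(d : ℝ) := Real.sqrt_pos.2 hd0
  have hm : annulus r x = annulus r y := congrArg Prod.fst h
  set R : ℝ := r * 2 ^ annulus r x with hR
  have hR0 : 0 < R := by positivity
  set k : ℝ := √d * 2 ^ l / R with hk
  have hk0 : 0 < k := by positivity
  have hi : ∀ i, ‖(x - y) i‖ ≤ 1 / k := by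
    intro i
    have hz := congrFun (congrArg Prod.snd h) i
    simp only [gridCell] at hz
    rw [← hm] at hz
    have := Int.abs_sub_lt_one_of_floor_eq_floor hz
    rw [← mul_sub, abs_mul, abs_of_pos hk0] at this
    rw [le_div_iff₀ hk0, mul_comm, Real.norm_eq_abs]
    exact this.le
  rw [EuclideanSpace.norm_eq]
  calc √(∑ i, ‖(x - y) i‖ ^ 2) ≤ √(∑ _i : Fin d, (1 / k) ^ 2) := by
        refine Real.sqrt_le_sqrt (Finset.sum_le_sum fun i _ => ?_)
        exact pow_le_pow_left₀ (norm_nonneg _) (hi i) 2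
    _ = √d * (1 / k) := by
        rw [Finset.sum_const, Finset.card_univ, Fintype.card_fin, nsmul_eq_mul,
          Real.sqrt_mul hd0.le, Real.sqrt_sq (by positivity)]
    _ = R / 2 ^ l := by rw [hk]; field_simp

/-- The indices of the cubes of one annulus at level `l`. -/
noncomputable def gridIndices (d l : ℕ) : Finset (Fin d → ℤ) :=
  (Fintype.piFinset fun _ => Finset.Icc (-(d * 2 ^ (l + 1) : ℤ)) (d * 2 ^ (l + 1))).filter
    fun z => ∑ i, |z i| ≤ d * 2 ^ (l + 1)

theorem sum_abs_le_sqrt_mul_norm (x : EuclideanSpace ℝ (Fin d)) : ∑ i, |x i| ≤ √d * ‖x‖ := by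
  rw [EuclideanSpace.norm_eq, ← Real.sqrt_mul (Nat.cast_nonneg d)]
  refine Real.le_sqrt_of_sq_le ?_
  have := sq_sum_le_card_mul_sum_sq (s := Finset.univ) (f := fun i : Fin d => |x i|)
  simpa using this

/-- The side of a cube is R/(√d 2^l) and the ℓ¹ norm is at most √d times the Euclidean one, so
rescaled points have ℓ¹ norm at most d 2^l; rounding adds at most 1 per coordinate. -/
theorem gridCell_snd_mem (hd : 1 ≤ d) {r : ℝ} (hr : 0 < r) (l : ℕ)
    (x : EuclideanSpace ℝ (Fin d)) : (gridCell r l x).2 ∈ gridIndices d l := by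
  have hd0 : (0 : ℝ) < d := by exact_mod_cast hd
  set R : ℝ := r * 2 ^ annulus r x with hR
  have hR0 : 0 < R := by positivity
  set k : ℝ := √d * 2 ^ l / R with hk
  have hk0 : 0 < k := by positivity
  have hfl : ∀ y : ℝ, |(⌊y⌋ : ℝ)| ≤ |y| + 1 := by
    intro y
    have h1 := Int.floor_le y
    have h2 := Int.lt_floor_add_one y
    rw [abs_le]
    constructor
    · linarith [neg_abs_le y]
    · linarith [le_abs_self y]
  have hsum : ∑ i, |(gridCell r l x).2 i| ≤ d * 2 ^ (l + 1) := by
    have : ((∑ i, |(gridCell r l x).2 i| : ℤ) : ℝ) ≤ ((d * 2 ^ (l + 1) : ℤ) : ℝ) := by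
      push_cast
      calc ∑ i, |((gridCell r l x).2 i : ℝ)| ≤ ∑ i, (k * |x i| + 1) := by
            refine Finset.sum_le_sum fun i _ => ?_
            have h := hfl (k * x i)
            rwa [abs_mul, abs_of_pos hk0] at h
        _ = k * ∑ i, |x i| + d := by
            rw [Finset.sum_add_distrib, ← Finset.mul_sum]
            simp
        _ ≤ k * (√d * R) + d := by
            gcongr
            refine (sum_abs_le_sqrt_mul_norm x).trans ?_
            gcongr
            exact norm_le_annulus hr x
        _ = d * 2 ^ l + d * 1 := by
            rw [hk]
            field_simp
            rw [Real.sq_sqrt hd0.le]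
            ring
        _ ≤ d * 2 ^ l + d * 2 ^ l := by
            gcongr
            exact one_le_pow₀ one_le_two
        _ = _ := by ring
    exact_mod_cast this
  rw [gridIndices, Finset.mem_filter, Fintype.mem_piFinset]
  refine ⟨fun i => ?_, hsum⟩
  rw [Finset.mem_Icc, ← abs_le]
  exact (Finset.single_le_sum (f := fun i => |(gridCell r l x).2 i|) (fun i _ => abs_nonneg _)
    (Finset.mem_univ i)).trans hsum

theorem sum_pow_natAbs_le {w : ℝ} (hw0 : 0 ≤ w) (hw : w < 1) (K : ℕ) :
    ∑ k ∈ Finset.Icc (-(K : ℤ)) K, w ^ k.natAbs ≤ 2 * (1 - w)⁻¹ := by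
  have hg : ∑ i ∈ Finset.range (K + 1), w ^ i ≤ (1 - w)⁻¹ := by
    rw [← tsum_geometric_of_lt_one hw0 hw]
    exact (summable_geometric_of_lt_one hw0 hw).sum_le_tsum _ fun i _ => by positivity
  have hsub : Finset.Icc (-(K : ℤ)) K ⊆
      (Finset.range (K + 1)).image (fun i : ℕ => (i : ℤ)) ∪
        (Finset.range (K + 1)).image (fun i : ℕ => -(i : ℤ)) := by
    intro k hk
    rw [Finset.mem_Icc] at hk
    simp only [Finset.mem_union, Finset.mem_image, Finset.mem_range]
    rcases le_total 0 k with h | h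
    · exact Or.inl ⟨k.natAbs, by omega, by omega⟩
    · exact Or.inr ⟨k.natAbs, by omega, by omega⟩
  calc _ ≤ ∑ k ∈ (Finset.range (K + 1)).image (fun i : ℕ => (i : ℤ)) ∪
        (Finset.range (K + 1)).image (fun i : ℕ => -(i : ℤ)), w ^ k.natAbs :=
        Finset.sum_le_sum_of_subset_of_nonneg hsub fun _ _ _ => by positivity
    _ ≤ ∑ k ∈ (Finset.range (K + 1)).image (fun i : ℕ => (i : ℤ)), w ^ k.natAbs +
        ∑ k ∈ (Finset.range (K + 1)).image (fun i : ℕ => -(i : ℤ)), w ^ k.natAbs := by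
        rw [← Finset.sum_union_inter]
        exact le_add_of_nonneg_right (Finset.sum_nonneg fun _ _ => by positivity)
    _ = ∑ i ∈ Finset.range (K + 1), w ^ i + ∑ i ∈ Finset.range (K + 1), w ^ i := by
        rw [Finset.sum_image (fun a _ b _ h => by simpa using h),
          Finset.sum_image (fun a _ b _ h => by simpa using h)]
        simp
    _ ≤ _ := by linarith

theorem card_gridIndices_le (d l : ℕ) : ((gridIndices d l).card : ℝ) ≤ (2 ^ (l + 5)) ^ d := by
  set M : ℝ := 2 ^ (l + 1) with hM
  have hM0 : 0 < M := by positivity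
  -- Exponential-moment count of an ℓ¹ ball: each index z has e^d ∏ w^|z_i| ≥ 1, and summing over
  -- the box factorises into (e ∑ w^|k|)^d. Counting the box itself would lose a factor of order
  -- d^d.
  set w : ℝ := Real.exp (-(1 / M)) with hw
  have hw1 : w ≤ M / (M + 1) := by
    have h1 : 1 / M + 1 ≤ Real.exp (1 / M) := Real.add_one_le_exp _
    rw [hw, Real.exp_neg, inv_le_comm₀ (Real.exp_pos _) (by positivity), inv_div]
    calc (M + 1) / M = 1 / M + 1 := by field_simp; ring
      _ ≤ _ := h1
  have hw2 : (1 - w)⁻¹ ≤ M + 1 := by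
    rw [inv_le_comm₀ _ (by positivity)]
    · calc (M + 1)⁻¹ = 1 - M / (M + 1) := by field_simp; ring
        _ ≤ _ := by linarith
    · have : M / (M + 1) < 1 := by rw [div_lt_one (by positivity)]; linarith
      linarith
  have hwlt : w < 1 := hw1.trans_lt (by rw [div_lt_one (by positivity)]; linarith)
  have key : ∀ z ∈ gridIndices d l, (1 : ℝ) ≤ Real.exp 1 ^ d * ∏ i, w ^ (z i).natAbs := by
    intro z hz
    have hz2 := (Finset.mem_filter.1 hz).2
    rw [Finset.prod_pow_eq_pow_sum, hw, ← Real.exp_nat_mul, ← Real.exp_nat_mul, ← Real.exp_add]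
    refine Real.one_le_exp ?_
    have : ((∑ i, (z i).natAbs : ℕ) : ℝ) ≤ d * M := by
      have h3 : ((∑ i, (z i).natAbs : ℕ) : ℤ) ≤ d * 2 ^ (l + 1) := by
        push_cast
        simpa using hz2
      have h4 : ((((∑ i, (z i).natAbs : ℕ) : ℤ)) : ℝ) ≤ ((d * 2 ^ (l + 1) : ℤ) : ℝ) := by
        exact_mod_cast h3
      rw [Int.cast_natCast] at h4
      refine h4.trans (le_of_eq ?_)
      push_cast
      rw [hM]
    have h5 : ((∑ i, (z i).natAbs : ℕ) : ℝ) * (1 / M) ≤ d := by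
      rw [mul_one_div, div_le_iff₀ hM0]
      exact this
    linarith
  calc ((gridIndices d l).card : ℝ) = ∑ z ∈ gridIndices d l, (1 : ℝ) := by simp
    _ ≤ ∑ z ∈ gridIndices d l, Real.exp 1 ^ d * ∏ i, w ^ (z i).natAbs := Finset.sum_le_sum key
    _ ≤ ∑ z ∈ Fintype.piFinset fun _ : Fin d =>
          Finset.Icc (-(d * 2 ^ (l + 1) : ℤ)) (d * 2 ^ (l + 1)),
          Real.exp 1 ^ d * ∏ i, w ^ (z i).natAbs :=
        Finset.sum_le_sum_of_subset_of_nonneg (Finset.filter_subset _ _)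
          fun _ _ _ => by positivity
    _ = Real.exp 1 ^ d * (∑ k ∈ Finset.Icc (-(d * 2 ^ (l + 1) : ℤ)) (d * 2 ^ (l + 1)),
          w ^ k.natAbs) ^ d := by
        rw [← Finset.mul_sum, ← Finset.prod_univ_sum
          (fun _ : Fin d => Finset.Icc (-(d * 2 ^ (l + 1) : ℤ)) (d * 2 ^ (l + 1)))
          (fun _ k => w ^ k.natAbs)]
        simp
    _ ≤ Real.exp 1 ^ d * (2 * (M + 1)) ^ d := by
        gcongr
        have := sum_pow_natAbs_le (by positivity) hwlt (d * 2 ^ (l + 1))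
        push_cast at this
        linarith
    _ = (Real.exp 1 * (2 * (M + 1))) ^ d := (mul_pow _ _ _).symm
    _ ≤ _ := by
        gcongr
        have h1 : (1 : ℝ) ≤ 2 ^ l := one_le_pow₀ one_le_two
        have h2 : M = 2 * 2 ^ l := by rw [hM]; ring
        have h3 : Real.exp 1 ≤ 3 := Real.exp_one_lt_three.le
        calc Real.exp 1 * (2 * (M + 1)) ≤ 3 * (2 * (M + 1)) := by gcongr
          _ ≤ 32 * 2 ^ l := by rw [h2]; linarith
          _ = _ := by ring

/-- The cost of moving mass within a cell of level `l`. -/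
noncomputable def cellCost (d : ℕ) (p r : ℝ) (l : ℕ) (c : ℕ × (Fin d → ℤ)) : ℝ≥0∞ :=
  ENNReal.ofReal ((r * 2 ^ c.1 / 2 ^ l) ^ p)

theorem cellCost_parentCell {p r : ℝ} (hr : 0 < r) (l : ℕ) (c : ℕ × (Fin d → ℤ)) :
    cellCost d p r l (parentCell c) = ENNReal.ofReal (2 ^ p) * cellCost d p r (l + 1) c := by
  rw [cellCost, cellCost, ← ENNReal.ofReal_mul (by positivity),
    ← Real.mul_rpow (by positivity) (by positivity)]
  congr 2
  simp only [parentCell]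
  rw [pow_succ]
  field_simp

theorem enorm_rpow_eq_ofReal {E : Type*} [NormedAddCommGroup E] {p : ℝ} (hp : 0 ≤ p) (x : E) :
    ‖x‖ₑ ^ p = ENNReal.ofReal (‖x‖ ^ p) := by
  rw [← ofReal_norm, ENNReal.ofReal_rpow_of_nonneg (norm_nonneg _) hp]

/-- The total discrepancy of two measures at level `l`, weighted by the costs of the cells. -/
noncomputable def levelCost (p r : ℝ) (μ ν : Measure (EuclideanSpace ℝ (Fin d))) (l : ℕ) : ℝ≥0∞ :=
  ∑' i, cellCost d p r l i * discrepancy μ ν (gridCell r l ⁻¹' {i})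

theorem enorm_sub_rpow_le_cellCost (hd : 1 ≤ d) {p r : ℝ} (hp : 0 ≤ p) (hr : 0 < r) (l : ℕ)
    {x y : EuclideanSpace ℝ (Fin d)} (h : gridCell r l x = gridCell r l y) :
    ‖x - y‖ₑ ^ p ≤ cellCost d p r l (gridCell r l x) := by
  rw [enorm_rpow_eq_ofReal hp]
  refine ENNReal.ofReal_le_ofReal (Real.rpow_le_rpow (norm_nonneg _) ?_ hp)
  exact norm_sub_le_of_gridCell_eq hd hr h

/-- Induction on the level. The factor 2^p arises at level 0 from |x - y| ≤ 2 max(|x|, |y|), and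
later from comparing the cost of a cell with that of its parent. -/
theorem partialTransport_gridCell (hd : 1 ≤ d) {p r : ℝ} (hp : 0 ≤ p) (hr : 0 < r)
    (μ ν : Measure (EuclideanSpace ℝ (Fin d))) [IsProbabilityMeasure μ] [IsProbabilityMeasure ν]
    (L : ℕ) :
    PartialTransport μ ν (fun z => ‖z.1 - z.2‖ₑ ^ p) (gridCell r L)
      (ENNReal.ofReal (2 ^ p) * ∑ l ∈ Finset.range (L + 1), levelCost p r μ ν l +
        ∑ l ∈ Finset.range L, levelCost p r μ ν l) := by
  have hcell := fun l (x y : EuclideanSpace ℝ (Fin d)) =>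
    enorm_sub_rpow_le_cellCost hd hp hr l (x := x) (y := y)
  have hmono : ∀ {μ ν : Measure (EuclideanSpace ℝ (Fin d))} {c π} {K K' : ℝ≥0∞}, K ≤ K' →
      PartialTransport (ι := ℕ × (Fin d → ℤ)) μ ν c π K → PartialTransport μ ν c π K' := by
    rintro μ ν c π K K' hK ⟨ξ, s, t, h1, h2, h3, h4, h5, h6⟩
    exact ⟨ξ, s, t, h1, h2, h3, h4, h5, h6.trans hK⟩
  induction L with
  | zero =>
    refine hmono ?_ (PartialTransport.of_univ (by simp) (measurable_gridCell r 0)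
      (G := fun i => ENNReal.ofReal (2 ^ p) * cellCost d p r 0 i) ?_)
    · simp only [mul_assoc, ENNReal.tsum_mul_left]
      rw [zero_add, Finset.sum_range_one]
      exact le_self_add
    · have key : ∀ x y : EuclideanSpace ℝ (Fin d), ‖x‖ ≤ ‖y‖ → ‖x - y‖ₑ ^ p ≤
          ENNReal.ofReal (2 ^ p) * cellCost d p r 0 (gridCell r 0 y) := by
        intro x y hxy
        rw [enorm_rpow_eq_ofReal hp, cellCost, ← ENNReal.ofReal_mul (by positivity),
          ← Real.mul_rpow (by positivity) (by positivity)]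
        refine ENNReal.ofReal_le_ofReal (Real.rpow_le_rpow (norm_nonneg _) ?_ hp)
        have h1 := norm_le_annulus hr y
        have h2 := norm_sub_le x y
        rw [pow_zero, div_one]
        change _ ≤ 2 * (r * 2 ^ annulus r y)
        linarith
      intro x y
      rcases le_total ‖x‖ ‖y‖ with h | h
      · exact (key x y h).trans le_add_self
      · simp only
        rw [← neg_sub y x, enorm_neg]
        exact (key y x h).trans le_self_add
  | succ L ih =>
    have hpar : (fun x => parentCell (gridCell r (L + 1) x)) =
      (gridCell r L : EuclideanSpace ℝ (Fin d) → _) := funext fun x => parentCell_gridCell r L x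
    rw [← hpar] at ih
    refine hmono ?_ (PartialTransport.refine (measurable_gridCell r (L + 1))
      (G := cellCost d p r L) ?_ ih)
    · rw [hpar]
      simp only [cellCost_parentCell hr, mul_assoc, ENNReal.tsum_mul_left]
      change _ + (ENNReal.ofReal (2 ^ p) * levelCost p r μ ν (L + 1) + levelCost p r μ ν L) ≤ _
      rw [Finset.sum_range_succ _ (L + 1), Finset.sum_range_succ _ L, mul_add]
      exact le_of_eq (by ring)
    · intro x y h
      rw [parentCell_gridCell, parentCell_gridCell] at h
      rw [parentCell_gridCell]
      exact hcell L x y h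

/-- The multiscale bound of the Wasserstein distance. -/
theorem wasserstein_le_levelCost (hd : 1 ≤ d) {p r : ℝ} (hp : 0 < p) (hr : 0 < r)
    (μ ν : Measure (EuclideanSpace ℝ (Fin d))) [IsProbabilityMeasure μ] [IsProbabilityMeasure ν]
    (L : ℕ) :
    wasserstein p μ ν ≤ ((ENNReal.ofReal (2 ^ p) + 1) * ∑' l, levelCost p r μ ν l +
      2 * ∫⁻ x, cellCost d p r L (gridCell r L x) ∂ν) ^ (1 / p) := by
  obtain ⟨ξ, hξ, h⟩ := (partialTransport_gridCell hd hp.le hr μ ν L).exists_coupling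
    (measurable_gridCell r L) (G := cellCost d p r L)
    fun x y h => enorm_sub_rpow_le_cellCost hd hp.le hr L h
  refine (iInf₂_le ξ hξ).trans (ENNReal.rpow_le_rpow (h.trans ?_) (by positivity))
  rw [add_mul, one_mul]
  gcongr <;> exact ENNReal.sum_le_tsum _

end Grid

/-! ### Expected discrepancies of the empirical measure -/

section Expectation

theorem lintegral_rpow_one_div_le {Ω : Type*} [MeasurableSpace Ω] {P : Measure Ω}
    [IsProbabilityMeasure P] {p : ℝ} (hp : 1 ≤ p) {f : Ω → ℝ≥0∞} (hf : AEMeasurable f P) :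
    ∫⁻ ω, f ω ^ (1 / p) ∂P ≤ (∫⁻ ω, f ω ∂P) ^ (1 / p) := by
  have h := eLpNorm'_le_eLpNorm'_of_exponent_le (f := fun ω => f ω ^ (1 / p)) one_pos hp P
    (hf.pow_const _).aestronglyMeasurable
  have hp0 : p ≠ 0 := by linarith
  simpa [eLpNorm', ← ENNReal.rpow_mul, hp0] using h

variable {E : Type*} [MeasurableSpace E] {n : ℕ}

theorem empiricalMeasure_apply (x : Fin n → E) {A : Set E} (hA : MeasurableSet A) :
    empiricalMeasure x A = (n : ℝ≥0∞)⁻¹ * ∑ i, A.indicator 1 (x i) := by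
  simp [empiricalMeasure, Measure.dirac_apply' _ hA]

theorem isProbabilityMeasure_empiricalMeasure (hn : 1 ≤ n) (x : Fin n → E) :
    IsProbabilityMeasure (empiricalMeasure x) := by
  constructor
  rw [empiricalMeasure_apply x MeasurableSet.univ]
  simp only [Set.indicator_univ, Pi.one_apply, Finset.sum_const, Finset.card_univ,
    Fintype.card_fin, nsmul_eq_mul, mul_one]
  exact ENNReal.inv_mul_cancel (by exact_mod_cast (by omega : n ≠ 0)) (ENNReal.natCast_ne_top n)

theorem discrepancy_eq_ofReal (μ ν : Measure E) [IsFiniteMeasure μ] [IsFiniteMeasure ν]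
    (A : Set E) : discrepancy μ ν A = ENNReal.ofReal |μ.real A - ν.real A| := by
  rw [discrepancy, ← ofReal_measureReal (μ := μ), ← ofReal_measureReal (μ := ν),
    ← ENNReal.ofReal_sub _ measureReal_nonneg, ← ENNReal.ofReal_sub _ measureReal_nonneg]
  rcases le_total (μ.real A) (ν.real A) with h | h
  · rw [ENNReal.ofReal_of_nonpos (by linarith : μ.real A - ν.real A ≤ 0), zero_add,
      abs_of_nonpos (by linarith), neg_sub]
  · rw [ENNReal.ofReal_of_nonpos (by linarith : ν.real A - μ.real A ≤ 0), add_zero,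
      abs_of_nonneg (by linarith)]

variable {Ω : Type*} [MeasurableSpace Ω] {P : Measure Ω} {μ : Measure E} {X : Fin n → Ω → E}

theorem aemeasurable_empiricalMeasure (hX : ∀ i, HasLaw (X i) μ P) {A : Set E}
    (hA : MeasurableSet A) : AEMeasurable (fun ω => empiricalMeasure (fun i => X i ω) A) P := by
  simp only [empiricalMeasure_apply _ hA]
  refine AEMeasurable.const_mul (Finset.aemeasurable_fun_sum _ fun i _ => ?_) _
  exact (measurable_one.indicator hA).comp_aemeasurable (hX i).aemeasurable

theorem aemeasurable_discrepancy (hX : ∀ i, HasLaw (X i) μ P) {A : Set E}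
    (hA : MeasurableSet A) :
    AEMeasurable (fun ω => discrepancy (empiricalMeasure fun i => X i ω) μ A) P := by
  have h := aemeasurable_empiricalMeasure hX hA
  exact (h.sub_const _).add (aemeasurable_const.sub h)

theorem lintegral_empiricalMeasure (hn : 1 ≤ n) (hX : ∀ i, HasLaw (X i) μ P) {A : Set E}
    (hA : MeasurableSet A) : ∫⁻ ω, empiricalMeasure (fun i => X i ω) A ∂P = μ A := by
  have hm : Measurable (A.indicator (1 : E → ℝ≥0∞)) := measurable_one.indicator hA
  have hm' : ∀ i, AEMeasurable (fun ω => A.indicator (1 : E → ℝ≥0∞) (X i ω)) P := fun i =>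
    hm.comp_aemeasurable (hX i).aemeasurable
  simp only [empiricalMeasure_apply _ hA]
  rw [lintegral_const_mul' _ _ (by simpa using (by omega : n ≠ 0)),
    lintegral_finsetSum' _ fun i _ => hm' i]
  simp only [fun i => (hX i).lintegral_comp hm.aemeasurable, lintegral_indicator_one hA,
    Finset.sum_const, Finset.card_univ, Fintype.card_fin, nsmul_eq_mul]
  rw [← mul_assoc, ENNReal.inv_mul_cancel (by exact_mod_cast (by omega : n ≠ 0))
    (ENNReal.natCast_ne_top n), one_mul]

theorem lintegral_discrepancy_le_two_mul [IsProbabilityMeasure P] (hn : 1 ≤ n)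
    (hX : ∀ i, HasLaw (X i) μ P) {A : Set E} (hA : MeasurableSet A) :
    ∫⁻ ω, discrepancy (empiricalMeasure fun i => X i ω) μ A ∂P ≤ 2 * μ A := by
  calc _ ≤ ∫⁻ ω, (empiricalMeasure (fun i => X i ω) A + μ A) ∂P :=
        lintegral_mono fun ω => add_le_add tsub_le_self tsub_le_self
    _ = 2 * μ A := by
        rw [lintegral_add_right _ measurable_const, lintegral_empiricalMeasure hn hX hA,
          lintegral_const, measure_univ, mul_one, two_mul]

/-- The variance of an indicator is at most μ(A), independence adds the variances, and Jensen's
inequality bounds the first moment of the deviation by the root of the second. -/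
theorem lintegral_discrepancy_le_sqrt [IsProbabilityMeasure P] [IsProbabilityMeasure μ]
    (hn : 1 ≤ n) (hX : ∀ i, HasLaw (X i) μ P) (hind : iIndepFun X P) {A : Set E}
    (hA : MeasurableSet A) :
    ∫⁻ ω, discrepancy (empiricalMeasure fun i => X i ω) μ A ∂P ≤ (μ A / n) ^ (1 / 2 : ℝ) := by
  have hn0 : (0 : ℝ) < n := by exact_mod_cast hn
  set g : E → ℝ := A.indicator 1 with hg
  have hgm : Measurable g := measurable_one.indicator hA
  have hg1 : ∀ x, ‖g x‖ ≤ 1 := fun x => by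
    by_cases h : x ∈ A <;> simp [hg, h]
  have hL : ∀ i, MemLp (fun ω => g (X i ω)) 2 P := fun i =>
    MemLp.of_bound (hgm.comp_aemeasurable (hX i).aemeasurable).aestronglyMeasurable 1
      (Filter.Eventually.of_forall fun ω => hg1 _)
  have hint : ∀ i, ∫ ω, g (X i ω) ∂P = μ.real A := fun i => by
    have := (hX i).integral_comp (f := g) hgm.aestronglyMeasurable
    rw [Function.comp_def] at this
    rw [this, hg, integral_indicator_one hA]
  have hgsq : ∀ x, g x ^ 2 = g x := fun x => by
    by_cases h : x ∈ A <;> simp [hg, h]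
  have hvar : ∀ i, Var[fun ω => g (X i ω); P] ≤ μ.real A := fun i => by
    refine (variance_le_expectation_sq (hL i).aestronglyMeasurable).trans (le_of_eq ?_)
    simp only [Pi.pow_apply, hgsq, hint]
  set Y : Ω → ℝ := ∑ i, fun ω => g (X i ω) with hY
  have hYL : MemLp Y 2 P := memLp_finsetSum' _ fun i _ => hL i
  have hYvar : Var[Y; P] ≤ n * μ.real A := by
    rw [hY, IndepFun.variance_sum (fun i _ => hL i) fun i _ j _ hij =>
      (hind.comp (fun _ => g) (fun _ => hgm)).indepFun hij]
    refine (Finset.sum_le_sum fun i _ => hvar i).trans (le_of_eq ?_)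
    simp
  have hYint : ∫ ω, Y ω ∂P = n * μ.real A := by
    simp only [hY, Finset.sum_apply]
    rw [integral_finsetSum _ fun i _ => (hL i).integrable (by norm_num)]
    simp [hint]
  have hemp : ∀ ω, (empiricalMeasure fun i => X i ω).real A = (n : ℝ)⁻¹ * Y ω := fun ω => by
    rw [Measure.real, empiricalMeasure_apply _ hA, ENNReal.toReal_mul, ENNReal.toReal_inv,
      ENNReal.toReal_natCast, ENNReal.toReal_sum]
    · congr 1
      rw [hY, Finset.sum_apply]
      refine Finset.sum_congr rfl fun i _ => ?_
      by_cases h : X i ω ∈ A <;> simp [hg, h]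
    · intro i _
      by_cases h : X i ω ∈ A <;> simp [h]
  have hdis : ∀ ω, discrepancy (empiricalMeasure fun i => X i ω) μ A ^ (2 : ℝ) =
      ENNReal.ofReal ((n : ℝ)⁻¹ ^ 2) * ENNReal.ofReal ((Y ω - ∫ ω', Y ω' ∂P) ^ 2) := fun ω => by
    have := isProbabilityMeasure_empiricalMeasure hn fun i => X i ω
    rw [discrepancy_eq_ofReal, hemp, hYint, ENNReal.ofReal_rpow_of_nonneg (abs_nonneg _) two_pos.le,
      ← ENNReal.ofReal_mul (by positivity), Real.rpow_two, sq_abs, ← mul_pow]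
    congr 2
    field_simp
  have hJ := lintegral_rpow_one_div_le (p := 2) one_le_two
    (f := fun ω => discrepancy (empiricalMeasure fun i => X i ω) μ A ^ (2 : ℝ))
    ((aemeasurable_discrepancy hX hA).pow_const _)
  have h2 : ∀ x : ℝ≥0∞, (x ^ (2 : ℝ)) ^ (1 / 2 : ℝ) = x := fun x => by
    rw [← ENNReal.rpow_mul]; norm_num
  simp only [h2] at hJ
  refine hJ.trans (ENNReal.rpow_le_rpow ?_ (by norm_num))
  simp only [hdis]
  rw [lintegral_const_mul' _ _ ENNReal.ofReal_ne_top, ← evariance_eq_lintegral_ofReal,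
    ← hYL.ofReal_variance_eq, ← ENNReal.ofReal_mul (by positivity), ← ofReal_measureReal,
    ← ENNReal.ofReal_natCast, ← ENNReal.ofReal_div_of_pos hn0]
  refine ENNReal.ofReal_le_ofReal ?_
  calc (n : ℝ)⁻¹ ^ 2 * Var[Y; P] ≤ (n : ℝ)⁻¹ ^ 2 * (n * μ.real A) := by gcongr
    _ = _ := by field_simp

theorem sum_rpow_half_le {ι : Type*} (S : Finset ι) (a : ι → ℝ≥0∞) :
    ∑ i ∈ S, a i ^ (1 / 2 : ℝ) ≤ (S.card * ∑ i ∈ S, a i) ^ (1 / 2 : ℝ) := by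
  have h := ENNReal.inner_le_Lp_mul_Lq S (fun _ => 1) (fun i => a i ^ (1 / 2 : ℝ))
    (p := 2) (q := 2) (Real.holderConjugate_iff.2 ⟨one_lt_two, by norm_num⟩)
  simp only [one_mul, ENNReal.one_rpow, Finset.sum_const, nsmul_eq_mul, mul_one,
    ← ENNReal.rpow_mul] at h
  rw [ENNReal.mul_rpow_of_nonneg _ _ (by norm_num)]
  simpa using h

/-- Expected total discrepancy over finitely many disjoint cells contained in `B`. -/
theorem sum_lintegral_discrepancy_le [IsProbabilityMeasure P] [IsProbabilityMeasure μ]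
    (hn : 1 ≤ n) (hX : ∀ i, HasLaw (X i) μ P) (hind : iIndepFun X P) {ι : Type*} (S : Finset ι)
    {A : ι → Set E} (hA : ∀ i, MeasurableSet (A i)) (hd : Pairwise (Function.onFun Disjoint A))
    {B : Set E} (hB : ∀ i, A i ⊆ B) :
    ∑ i ∈ S, ∫⁻ ω, discrepancy (empiricalMeasure fun i => X i ω) μ (A i) ∂P ≤
      min (2 * μ B) ((S.card * μ B / n) ^ (1 / 2 : ℝ)) := by
  have hsum : ∑ i ∈ S, μ (A i) ≤ μ B := by
    rw [← measure_biUnion_finset (fun i _ j _ hij => hd hij) fun i _ => hA i]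
    exact measure_mono (Set.iUnion₂_subset fun i _ => hB i)
  refine le_min ?_ ?_
  · refine (Finset.sum_le_sum fun i _ => lintegral_discrepancy_le_two_mul hn hX (hA i)).trans ?_
    rw [← Finset.mul_sum]
    gcongr
  · refine (Finset.sum_le_sum fun i _ => lintegral_discrepancy_le_sqrt hn hX hind (hA i)).trans ?_
    refine (sum_rpow_half_le S _).trans (ENNReal.rpow_le_rpow ?_ (by norm_num))
    simp only [div_eq_mul_inv]
    rw [← Finset.sum_mul, mul_assoc]
    gcongr

end Expectation

/-! ### Moment bounds and assembly of the estimate -/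

section Assembly

variable {d n : ℕ} {μ : Measure (EuclideanSpace ℝ (Fin d))}

/-- Markov's inequality for the annuli. -/
theorem measure_annulus_le {E : Type*} [NormedAddCommGroup E] [MeasurableSpace E]
    [OpensMeasurableSpace E] {μ : Measure E} [IsProbabilityMeasure μ] {q r : ℝ} (hq : 0 < q)
    (hr : 0 < r) (hμ : ∫⁻ x, ‖x‖ₑ ^ q ∂μ ≤ ENNReal.ofReal (r ^ q)) (m : ℕ) :
    μ (annulus r ⁻¹' {m}) ≤ ENNReal.ofReal (2 ^ (q - q * m)) := by
  cases m with
  | zero =>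
    -- Annulus 0 is the whole ball of radius r, where Markov's inequality says nothing; the extra
    -- factor 2^q makes the claim trivial.
    refine prob_le_one.trans ?_
    rw [← ENNReal.ofReal_one]
    refine ENNReal.ofReal_le_ofReal (Real.one_le_rpow one_le_two ?_)
    simpa using hq.le
  | succ k =>
    have hR : 0 < (r * 2 ^ k) ^ q := by positivity
    have h := mul_meas_ge_le_lintegral₀ (μ := μ) (f := fun x : E => ‖x‖ₑ ^ q)
      (measurable_enorm.pow_const q).aemeasurable (ENNReal.ofReal ((r * 2 ^ k) ^ q))
    have hsub : annulus r ⁻¹' {k + 1} ⊆ {x : E | ENNReal.ofReal ((r * 2 ^ k) ^ q) ≤ ‖x‖ₑ ^ q} := by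
      intro x hx
      rw [Set.mem_ofPred_eq, enorm_rpow_eq_ofReal hq.le]
      exact ENNReal.ofReal_le_ofReal
        (Real.rpow_le_rpow (by positivity) (lt_norm_of_annulus_eq hr hx).le hq.le)
    have h2 : ENNReal.ofReal ((r * 2 ^ k) ^ q) * μ (annulus r ⁻¹' {k + 1}) ≤
        ENNReal.ofReal (r ^ q) := by
      refine le_trans ?_ (h.trans hμ)
      gcongr
    rw [mul_comm, ← ENNReal.le_div_iff_mul_le (Or.inl (by simpa using hR))
      (Or.inl ENNReal.ofReal_ne_top), ← ENNReal.ofReal_div_of_pos hR] at h2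
    refine h2.trans (le_of_eq ?_)
    congr 1
    rw [Real.mul_rpow hr.le (by positivity), ← Real.rpow_natCast, ← Real.rpow_mul two_pos.le,
      div_mul_cancel_left₀ (by positivity), ← Real.rpow_neg two_pos.le]
    congr 1
    push_cast
    ring

theorem rpow_scale_eq {p r : ℝ} (hr : 0 < r) (m l : ℕ) :
    (r * 2 ^ m / 2 ^ l) ^ p = r ^ p * 2 ^ (p * m - p * l) := by
  rw [mul_div_assoc, Real.mul_rpow hr.le (by positivity), ← Real.rpow_natCast,
    ← Real.rpow_natCast, ← Real.rpow_sub two_pos, ← Real.rpow_mul two_pos.le]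
  congr 2
  ring

theorem aemeasurable_levelCost {Ω : Type*} [MeasurableSpace Ω] {P : Measure Ω}
    {X : Fin n → Ω → EuclideanSpace ℝ (Fin d)} (hX : ∀ i, HasLaw (X i) μ P) (p r : ℝ) (l : ℕ) :
    AEMeasurable (fun ω => levelCost p r (empiricalMeasure fun i => X i ω) μ l) P := by
  refine AEMeasurable.tsum fun i => AEMeasurable.const_mul ?_ _
  exact aemeasurable_discrepancy hX (measurable_gridCell r l (measurableSet_singleton i))

/-- All cells of one annulus at one level have the same cost, and only the cubes indexed by
`gridIndices d l` meet it, so the sum over cells reduces to a finite one per annulus. -/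
theorem lintegral_levelCost_le {Ω : Type*} [MeasurableSpace Ω] {P : Measure Ω}
    [IsProbabilityMeasure P] [IsProbabilityMeasure μ] (hd : 1 ≤ d) (hn : 1 ≤ n)
    {X : Fin n → Ω → EuclideanSpace ℝ (Fin d)} (hX : ∀ i, HasLaw (X i) μ P)
    (hind : iIndepFun X P) (p : ℝ) {r : ℝ} (hr : 0 < r) (l : ℕ) :
    ∫⁻ ω, levelCost p r (empiricalMeasure fun i => X i ω) μ l ∂P ≤
      ∑' m : ℕ, ENNReal.ofReal ((r * 2 ^ m / 2 ^ l) ^ p) *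
        min (2 * μ (annulus r ⁻¹' {m}))
          (((gridIndices d l).card * μ (annulus r ⁻¹' {m}) / n) ^ (1 / 2 : ℝ)) := by
  have hmeas : ∀ c, MeasurableSet (gridCell (d := d) r l ⁻¹' {c}) := fun c =>
    measurable_gridCell r l (measurableSet_singleton c)
  simp only [levelCost]
  rw [lintegral_tsum fun c => (aemeasurable_discrepancy hX (hmeas c)).const_mul _,
    ENNReal.tsum_prod (f := fun m z => ∫⁻ ω, cellCost d p r l (m, z) *
      discrepancy (empiricalMeasure fun i => X i ω) μ (gridCell r l ⁻¹' {(m, z)}) ∂P)]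
  refine ENNReal.tsum_le_tsum fun m => ?_
  have hzero : ∀ z ∉ gridIndices d l, ∫⁻ ω, cellCost d p r l (m, z) *
      discrepancy (empiricalMeasure fun i => X i ω) μ (gridCell r l ⁻¹' {(m, z)}) ∂P = 0 := by
    intro z hz
    have : gridCell (d := d) r l ⁻¹' {(m, z)} = ∅ := by
      refine Set.eq_empty_of_forall_notMem fun x hx => hz ?_
      have h := gridCell_snd_mem hd hr l x
      rwa [Set.mem_singleton_iff.1 hx] at h
    simp [this, discrepancy]
  rw [tsum_eq_sum hzero]
  simp only [lintegral_const_mul' _ _ ENNReal.ofReal_ne_top, cellCost]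
  rw [← Finset.mul_sum]
  gcongr
  refine sum_lintegral_discrepancy_le hn hX hind (gridIndices d l) (fun z => hmeas (m, z)) ?_ ?_
  · intro z z' hzz
    refine Disjoint.preimage _ (Set.disjoint_singleton.2 fun h => hzz ?_)
    exact congrArg Prod.snd h
  · intro z x hx
    exact congrArg Prod.fst (Set.mem_singleton_iff.1 hx)

theorem min_measure_annulus_le {q N : ℝ} (hq : 0 < q) (hN : (2 : ℝ) ^ N = n) (l m : ℕ)
    {a : ℝ≥0∞} (ha : a ≤ ENNReal.ofReal (2 ^ (q - q * m))) :
    min (2 * a) (((gridIndices d l).card * a / n) ^ (1 / 2 : ℝ)) ≤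
      ENNReal.ofReal (2 ^ (q + 1 - q * m) *
        min 1 (2 ^ (-((N - q * m - d * ((l + 5 : ℕ) : ℝ)) / 2)))) := by
  rw [mul_min_of_nonneg _ _ (by positivity), mul_one, ENNReal.ofReal_min]
  refine min_le_min ?_ ?_
  · calc 2 * a ≤ ENNReal.ofReal 2 * ENNReal.ofReal (2 ^ (q - q * m)) := by
          rw [ENNReal.ofReal_ofNat]; gcongr
      _ = _ := by
          rw [← ENNReal.ofReal_mul two_pos.le, show q + 1 - q * m = 1 + (q - q * m) by ring,
            Real.rpow_add two_pos, Real.rpow_one]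
  · have hn0 : (0 : ℝ) < n := hN ▸ Real.rpow_pos_of_pos two_pos N
    have hcard : ((gridIndices d l).card : ℝ≥0∞) ≤ ENNReal.ofReal (2 ^ (((l + 5 : ℕ) : ℝ) * d)) := by
      rw [← ENNReal.ofReal_natCast, Real.rpow_mul two_pos.le, Real.rpow_natCast, Real.rpow_natCast]
      exact ENNReal.ofReal_le_ofReal (card_gridIndices_le d l)
    calc (((gridIndices d l).card * a / n) ^ (1 / 2 : ℝ))
        ≤ (ENNReal.ofReal (2 ^ (((l + 5 : ℕ) : ℝ) * d)) * ENNReal.ofReal (2 ^ (q - q * m)) /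
            ENNReal.ofReal (2 ^ N)) ^ (1 / 2 : ℝ) := by
          rw [hN, ENNReal.ofReal_natCast]
          gcongr
      _ = ENNReal.ofReal (2 ^ ((((l + 5 : ℕ) : ℝ) * d + (q - q * m) - N) * (1 / 2))) := by
          rw [← ENNReal.ofReal_mul (by positivity), ← ENNReal.ofReal_div_of_pos (by positivity),
            ENNReal.ofReal_rpow_of_nonneg (by positivity) (by norm_num), ← Real.rpow_add two_pos,
            ← Real.rpow_sub two_pos, ← Real.rpow_mul two_pos.le]
      _ ≤ _ := by
          refine ENNReal.ofReal_le_ofReal ?_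
          rw [← Real.rpow_add two_pos]
          refine Real.rpow_le_rpow_of_exponent_le one_le_two ?_
          linarith

/-- Since the cube count is 2^((l+5)d), level l plays the role of scale j = l + 5. The shift costs
2^(5p), independent of d, and merely drops the first five scales. -/
theorem tsum_lintegral_levelCost_le {Ω : Type*} [MeasurableSpace Ω] {P : Measure Ω}
    [IsProbabilityMeasure P] [IsProbabilityMeasure μ] (hd : 1 ≤ d) (hn : 1 ≤ n)
    {X : Fin n → Ω → EuclideanSpace ℝ (Fin d)} (hX : ∀ i, HasLaw (X i) μ P)
    (hind : iIndepFun X P) (p : ℝ) {q r N : ℝ} (hq : 0 < q) (hr : 0 < r)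
    (hN : (2 : ℝ) ^ N = n) (hμ : ∫⁻ x, ‖x‖ₑ ^ q ∂μ ≤ ENNReal.ofReal (r ^ q)) :
    ∑' l, ∫⁻ ω, levelCost p r (empiricalMeasure fun i => X i ω) μ l ∂P ≤
      ENNReal.ofReal (r ^ p * 2 ^ (5 * p + q + 1)) * scaleSum p q d N := by
  set t : ℕ → ℕ → ℝ≥0∞ := fun m j => ENNReal.ofReal (2 ^ (-((q - p) * m + p * j)) *
    min 1 (2 ^ (-((N - q * m - d * j) / 2)))) with ht
  have hterm : ∀ l m : ℕ, ENNReal.ofReal ((r * 2 ^ m / 2 ^ l) ^ p) *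
        min (2 * μ (annulus r ⁻¹' {m}))
          (((gridIndices d l).card * μ (annulus r ⁻¹' {m}) / n) ^ (1 / 2 : ℝ)) ≤
      ENNReal.ofReal (r ^ p * 2 ^ (5 * p + q + 1)) * t m (l + 5) := by
    intro l m
    refine (mul_le_mul_right (min_measure_annulus_le hq hN l m
      (measure_annulus_le hq hr hμ m)) _).trans (le_of_eq ?_)
    rw [ht, ← ENNReal.ofReal_mul (by positivity), ← ENNReal.ofReal_mul (by positivity)]
    congr 1
    have e : (2 : ℝ) ^ (p * m - p * l) * 2 ^ (q + 1 - q * m) =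
        2 ^ (5 * p + q + 1) * 2 ^ (-((q - p) * m + p * ((l + 5 : ℕ) : ℝ))) := by
      rw [← Real.rpow_add two_pos, ← Real.rpow_add two_pos]
      congr 1
      push_cast
      ring
    rw [← mul_assoc, ← mul_assoc, rpow_scale_eq hr, mul_assoc (r ^ p), e, ← mul_assoc]
  calc _ ≤ ∑' (l : ℕ) (m : ℕ), ENNReal.ofReal (r ^ p * 2 ^ (5 * p + q + 1)) * t m (l + 5) :=
        ENNReal.tsum_le_tsum fun l => (lintegral_levelCost_le hd hn hX hind p hr l).trans
          (ENNReal.tsum_le_tsum fun m => hterm l m)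
    _ = ENNReal.ofReal (r ^ p * 2 ^ (5 * p + q + 1)) * ∑' (m : ℕ) (l : ℕ), t m (l + 5) := by
        simp only [ENNReal.tsum_mul_left]
        rw [ENNReal.tsum_comm]
    _ ≤ _ := by
        refine mul_le_mul_right (ENNReal.tsum_le_tsum fun m => ?_) _
        exact ENNReal.tsum_comp_le_tsum_of_injective (add_left_injective 5) (t m)

theorem exists_lintegral_cellCost_le {p q : ℝ} (hq : 0 < q) (hpq : p < q) :
    ∃ C : ℝ, 0 < C ∧ ∀ (d : ℕ) (μ : Measure (EuclideanSpace ℝ (Fin d))) [IsProbabilityMeasure μ]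
      (r : ℝ), 0 < r → ∫⁻ x, ‖x‖ₑ ^ q ∂μ ≤ ENNReal.ofReal (r ^ q) → ∀ L : ℕ,
        ∫⁻ x, cellCost d p r L (gridCell r L x) ∂μ ≤
          ENNReal.ofReal (r ^ p * (C * 2 ^ (-(p * L)))) := by
  obtain ⟨C, hC, h⟩ := exists_tsum_two_rpow_le (sub_pos.2 hpq)
  refine ⟨2 ^ q * C, by positivity, fun d μ _ r hr hμ L => ?_⟩
  have e : ∫⁻ x, cellCost d p r L (gridCell r L x) ∂μ =
      ∑' m : ℕ, ENNReal.ofReal ((r * 2 ^ m / 2 ^ L) ^ p) * μ (annulus r ⁻¹' {m}) :=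
    lintegral_comp_eq_tsum μ (measurable_annulus r)
      fun m => ENNReal.ofReal ((r * 2 ^ m / 2 ^ L) ^ p)
  rw [e]
  calc _ ≤ ∑' m : ℕ, ENNReal.ofReal (r ^ p * 2 ^ q * 2 ^ (-(p * L))) *
        ENNReal.ofReal (2 ^ (-((q - p) * m))) := by
        refine ENNReal.tsum_le_tsum fun m => ?_
        refine (mul_le_mul_right (measure_annulus_le hq hr hμ m) _).trans (le_of_eq ?_)
        rw [← ENNReal.ofReal_mul (by positivity), ← ENNReal.ofReal_mul (by positivity),
          rpow_scale_eq hr, mul_assoc, mul_assoc, mul_assoc, ← Real.rpow_add two_pos,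
          ← Real.rpow_add two_pos, ← Real.rpow_add two_pos]
        congr 3
        ring
    _ ≤ ENNReal.ofReal (r ^ p * 2 ^ q * 2 ^ (-(p * L))) * ENNReal.ofReal C := by
        rw [ENNReal.tsum_mul_left]
        gcongr
    _ = _ := by
        rw [← ENNReal.ofReal_mul (by positivity)]
        congr 1
        ring

theorem rateExponent_le_one {p q : ℝ} (hp : 1 ≤ p) (d : ℕ) : rateExponent p q d ≤ 1 := by
  refine (min_le_left _ _).trans ?_
  rw [div_le_one (by positivity)]
  exact le_max_of_le_left (by linarith)

theorem logExponent_le_two (p q : ℝ) (d : ℕ) : logExponent p q d ≤ 2 := by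
  unfold logExponent; split_ifs <;> norm_num

/-- Conversion from log₂ n to log n costs (log 2)^(-ζ/p), at most (log 2)^(-2) because ζ ≤ 2 and p ≥
1; the constant stays free of d. -/
theorem rpow_one_div_rate_le {p r K ρ ζ N : ℝ} (hp : 1 ≤ p) (hr : 0 < r) (hK : 0 < K)
    (hζ2 : ζ ≤ 2) (hn : 1 ≤ n) (hN : N = Real.log n / Real.log 2) :
    (r ^ p * K * 2 ^ (-(p * ρ * N)) * N ^ ζ) ^ (1 / p) ≤
      K ^ (1 / p) * (Real.log 2)⁻¹ ^ (2 : ℝ) * r * (n : ℝ) ^ (-ρ) * Real.log n ^ (ζ / p) := by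
  have hp0 : 0 < p := by linarith
  have hn0 : (0 : ℝ) < n := by exact_mod_cast hn
  have hl2 : 0 < Real.log 2 := Real.log_pos one_lt_two
  have hl2' : 1 ≤ (Real.log 2)⁻¹ := by
    rw [one_le_inv₀ hl2]
    linarith [Real.log_two_lt_d9]
  have hln : 0 ≤ Real.log n := Real.log_nonneg (by exact_mod_cast hn)
  have hN0 : 0 ≤ N := by rw [hN]; positivity
  have h2N : (2 : ℝ) ^ N = n := by
    rw [Real.rpow_def_of_pos two_pos, hN, mul_div_cancel₀ _ hl2.ne', Real.exp_log hn0]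
  have e1 : (2 : ℝ) ^ (-(p * ρ * N)) = ((n : ℝ) ^ (-ρ)) ^ p := by
    rw [← h2N, ← Real.rpow_mul two_pos.le, ← Real.rpow_mul two_pos.le]
    congr 1
    ring
  have e2 : N ^ ζ = ((Real.log 2)⁻¹ ^ (ζ / p) * Real.log n ^ (ζ / p)) ^ p := by
    rw [← Real.mul_rpow (by positivity) hln, ← Real.rpow_mul (by positivity),
      div_mul_cancel₀ _ hp0.ne', hN, div_eq_inv_mul]
  have hz : (Real.log 2)⁻¹ ^ (ζ / p) ≤ (Real.log 2)⁻¹ ^ (2 : ℝ) := by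
    refine Real.rpow_le_rpow_of_exponent_le hl2' ?_
    rw [div_le_iff₀ hp0]
    linarith
  rw [e1, e2, mul_right_comm (r ^ p), ← Real.mul_rpow hr.le (by positivity),
    mul_right_comm, ← Real.mul_rpow (by positivity) (by positivity),
    Real.mul_rpow (by positivity) hK.le, one_div, Real.rpow_rpow_inv (by positivity) hp0.ne']
  calc _ = K ^ p⁻¹ * (Real.log 2)⁻¹ ^ (ζ / p) * r * (n : ℝ) ^ (-ρ) * Real.log n ^ (ζ / p) := by
        ring
    _ ≤ _ := by gcongr

theorem exists_lintegral_wasserstein_le {p q : ℝ} (hp : 1 ≤ p) (hpq : p < q) :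
    ∃ c : ℝ, 0 < c ∧ ∀ (d n : ℕ), 1 ≤ d → 1 ≤ n → (logExponent p q d ≠ 0 → 2 ≤ n) →
      ∀ (μ : Measure (EuclideanSpace ℝ (Fin d))) [IsProbabilityMeasure μ] (r : ℝ), 0 < r →
      ∫⁻ x, ‖x‖ₑ ^ q ∂μ ≤ ENNReal.ofReal (r ^ q) →
      ∀ (Ω : Type*) [MeasurableSpace Ω] (P : Measure Ω) [IsProbabilityMeasure P]
        (X : Fin n → Ω → EuclideanSpace ℝ (Fin d)),
      (∀ i, HasLaw (X i) μ P) → iIndepFun X P →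
        ∫⁻ ω, wasserstein p (empiricalMeasure (fun i => X i ω)) μ ∂P ≤
          ENNReal.ofReal (c * r * (n : ℝ) ^ (-rateExponent p q d) *
            (Real.log n) ^ (logExponent p q d / p)) := by
  have hp0 : 0 < p := by linarith
  have hq0 : 0 < q := by linarith
  obtain ⟨C₁, hC₁, h₁⟩ := exists_scaleSum_le_uniform hp hpq
  obtain ⟨C₂, hC₂, h₂⟩ := exists_lintegral_cellCost_le hq0 hpq
  set K : ℝ := (2 ^ p + 1) * (2 ^ (5 * p + q + 1) * C₁) + 2 * C₂ with hK
  have hK0 : 0 < K := by positivity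
  have hl2 : 0 < Real.log 2 := Real.log_pos one_lt_two
  refine ⟨K ^ (1 / p) * (Real.log 2)⁻¹ ^ (2 : ℝ), by positivity, ?_⟩
  intro d n hd hn hn2 μ _ r hr hμ Ω _ P _ X hX hind
  have hn0 : (0 : ℝ) < n := by exact_mod_cast hn
  obtain ⟨N, hN⟩ : ∃ N, N = Real.log n / Real.log 2 := ⟨_, rfl⟩
  have h2N : (2 : ℝ) ^ N = n := by
    rw [Real.rpow_def_of_pos two_pos, hN, mul_div_cancel₀ _ hl2.ne', Real.exp_log hn0]
  have hN0 : 0 ≤ N := by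
    rw [hN]; exact div_nonneg (Real.log_nonneg (by exact_mod_cast hn)) hl2.le
  have hN1 : logExponent p q d ≠ 0 → 1 ≤ N := fun h => by
    rw [hN, one_le_div hl2]
    exact Real.log_le_log two_pos (by exact_mod_cast hn2 h)
  have hNn : N ≤ n := by
    refine (Real.rpow_le_rpow_left_iff one_lt_two).1 ?_
    rw [h2N, Real.rpow_natCast]
    exact_mod_cast Nat.lt_two_pow_self.le
  set ρ := rateExponent p q d with hρ
  set ζ := logExponent p q d with hζ
  -- The refinement stops at level n: the remainder is of order 2^(-pn), below the rate because the
  -- rate exponent is at most 1 and N = log₂ n ≤ n.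
  set T : ℝ≥0∞ := ∫⁻ x, cellCost d p r n (gridCell r n x) ∂μ with hT
  have hTle : T ≤ ENNReal.ofReal (r ^ p * C₂ * (2 ^ (-(p * ρ * N)) * N ^ ζ)) := by
    refine (h₂ d μ r hr hμ n).trans (ENNReal.ofReal_le_ofReal ?_)
    rw [← mul_assoc]
    gcongr
    refine le_trans (two_rpow_neg_le ?_) (le_mul_of_one_le_right (by positivity)
      (one_le_rpow_logExponent hN1))
    rw [mul_assoc]
    gcongr
    calc ρ * N ≤ 1 * N := by gcongr; exact rateExponent_le_one hp d
      _ ≤ n := by linarith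
  have hSle : ∑' l, ∫⁻ ω, levelCost p r (empiricalMeasure fun i => X i ω) μ l ∂P ≤
      ENNReal.ofReal (r ^ p * (2 ^ (5 * p + q + 1) * C₁) * (2 ^ (-(p * ρ * N)) * N ^ ζ)) := by
    refine (tsum_lintegral_levelCost_le hd hn hX hind p hq0 hr h2N hμ).trans ?_
    refine (mul_le_mul_right (h₁ d hd N hN0 hN1) _).trans (le_of_eq ?_)
    rw [← ENNReal.ofReal_mul (by positivity)]
    congr 1
    ring
  have hmeas : AEMeasurable (fun ω => ∑' l, levelCost p r (empiricalMeasure fun i => X i ω) μ l)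
      P := AEMeasurable.tsum fun l => aemeasurable_levelCost hX p r l
  calc _ ≤ ∫⁻ ω, ((ENNReal.ofReal (2 ^ p) + 1) *
        ∑' l, levelCost p r (empiricalMeasure fun i => X i ω) μ l + 2 * T) ^ (1 / p) ∂P := by
        refine lintegral_mono fun ω => ?_
        have := isProbabilityMeasure_empiricalMeasure hn fun i => X i ω
        exact wasserstein_le_levelCost hd hp0 hr _ μ n
    _ ≤ (∫⁻ ω, ((ENNReal.ofReal (2 ^ p) + 1) *
        ∑' l, levelCost p r (empiricalMeasure fun i => X i ω) μ l + 2 * T) ∂P) ^ (1 / p) :=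
        lintegral_rpow_one_div_le hp ((hmeas.const_mul _).add_const _)
    _ = ((ENNReal.ofReal (2 ^ p) + 1) *
        ∑' l, ∫⁻ ω, levelCost p r (empiricalMeasure fun i => X i ω) μ l ∂P + 2 * T) ^ (1 / p) := by
        rw [lintegral_add_right _ measurable_const, lintegral_const, measure_univ, mul_one,
          lintegral_const_mul'' _ hmeas,
          lintegral_tsum fun l => aemeasurable_levelCost hX p r l]
    _ ≤ (ENNReal.ofReal (r ^ p * K * 2 ^ (-(p * ρ * N)) * N ^ ζ)) ^ (1 / p) := by
        refine ENNReal.rpow_le_rpow ?_ (by positivity)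
        refine (add_le_add (mul_le_mul_right hSle _) (mul_le_mul_right hTle _)).trans
          (le_of_eq ?_)
        rw [← ENNReal.ofReal_one, ← ENNReal.ofReal_add (by positivity) zero_le_one,
          ← ENNReal.ofReal_ofNat 2, ← ENNReal.ofReal_mul (by positivity),
          ← ENNReal.ofReal_mul (by positivity), ← ENNReal.ofReal_add (by positivity)
          (by positivity)]
        congr 1
        rw [hK]
        ring
    _ ≤ _ := by
        rw [ENNReal.ofReal_rpow_of_nonneg (by positivity) (by positivity)]
        exact ENNReal.ofReal_le_ofReal (rpow_one_div_rate_le hp hr hK0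
          (logExponent_le_two p q d) hn hN)

end Assembly

theorem mainTheorem2 (p q : ℝ) (hp : 1 ≤ p) (hpq : p < q) :
    ∃ c : ℝ, 0 < c ∧
      ∀ (d n : ℕ), 1 ≤ d → 1 ≤ n → (logExponent p q d ≠ 0 → 2 ≤ n) →
      ∀ (μ : Measure (EuclideanSpace ℝ (Fin d))) [IsProbabilityMeasure μ],
      MemLp id (ENNReal.ofReal q) μ →
      ∀ (Ω : Type*) [MeasurableSpace Ω] (P : Measure Ω) [IsProbabilityMeasure P]
        (X : Fin n → Ω → EuclideanSpace ℝ (Fin d)),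
      (∀ i, HasLaw (X i) μ P) → iIndepFun X P →
        ∫⁻ ω, wasserstein p (empiricalMeasure (fun i => X i ω)) μ ∂P ≤
          ENNReal.ofReal (c * (∫ x, ‖x‖ ^ q ∂μ) ^ (1 / q) *
            (n : ℝ) ^ (-rateExponent p q d) * (Real.log n) ^ (logExponent p q d / p)) := by
  have hq0 : 0 < q := by linarith
  obtain ⟨c, hc, h⟩ := exists_lintegral_wasserstein_le hp hpq
  refine ⟨c, hc, fun d n hd hn hn2 μ _ hμ Ω _ P _ X hX hind => ?_⟩
  have hint : Integrable (fun x => ‖x‖ ^ q) μ := by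
    have := hμ.integrable_norm_rpow (by simpa using hq0) ENNReal.ofReal_ne_top
    simpa only [id, ENNReal.toReal_ofReal hq0.le] using this
  have hI : 0 ≤ ∫ x, ‖x‖ ^ q ∂μ := integral_nonneg fun x => by positivity
  have hmom : ∫⁻ x, ‖x‖ₑ ^ q ∂μ = ENNReal.ofReal (∫ x, ‖x‖ ^ q ∂μ) := by
    rw [ofReal_integral_eq_lintegral_ofReal hint
      (Filter.Eventually.of_forall fun x => by positivity)]
    simp only [enorm_rpow_eq_ofReal hq0.le]
  set M : ℝ := (∫ x, ‖x‖ ^ q ∂μ) ^ (1 / q) with hM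
  have hM0 : 0 ≤ M := by positivity
  have hMq : M ^ q = ∫ x, ‖x‖ ^ q ∂μ := by
    rw [hM, one_div, Real.rpow_inv_rpow hI hq0.ne']
  -- The grid needs a positive radius, while M vanishes for a Dirac mass at 0. The bound is
  -- therefore proved for all r > M and passed to the limit r ↓ M.
  have hcont : Continuous fun r : ℝ => ENNReal.ofReal (c * r *
      (n : ℝ) ^ (-rateExponent p q d) * (Real.log n) ^ (logExponent p q d / p)) :=
    ENNReal.continuous_ofReal.comp (by fun_prop)
  refine ge_of_tendsto (hcont.continuousWithinAt (s := Set.Ioi M) (x := M)) ?_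
  filter_upwards [self_mem_nhdsWithin] with r hr
  refine h d n hd hn hn2 μ r (hM0.trans_lt hr) ?_ Ω P X hX hind
  rw [hmom, ← hMq]
  exact ENNReal.ofReal_le_ofReal (Real.rpow_le_rpow hM0 (le_of_lt hr) hq0.le)
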